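/- Conventions. Rings are associative with $1$; a \emph{field} need not be commutative. For a ring $R$ let $\mathrm{GL}_2(R)$ be the group of invertible $2\times2$ matrices over $R$. The \emph{projective line} $\mathbb P(R)$ is the set of all submodules $R(a,b)$ of the left module $R^2$ where $(a,b)$ is the first row of a matrix in $\mathrm{GL}_2(R)$. Two points are \emph{distant} if they can be written as $R(a,b)$, $R(c,d)$ with $\begin{pmatrix}a&b\\c&d\end{pmatrix}\in\mathrm{GL}_2(R)$. Connectedness, connected components, distances and diameters (suprema of distances in a component) refer to the \emph{distant graph} on $\mathbb P(R)$, whose edges are the pairs of different distant points. Let $B_{12}(t)=\begin{pmatrix}1&t\\0&1\end{pmatrix}$, $B_{21}(t)=\begin{pmatrix}1&0\\t&1\end{pmatrix}$; let $\mathrm E_2(R)$ be the subgroup of $\mathrm{GL}_2(R)$ generated by all $B_{12}(t),B_{21}(t)$ with $t\in R$, and $\mathrm{GE}_2(R)$ the subgroup generated by $\mathrm E_2(R)$ and all invertible diagonal matrices. If $K$ is a subfield of $R$, the \emph{$K$-chains} are the images under $\mathrm{GL}_2(R)$ of the set of points $R(a,b)$ with $(a,b)$ the first row of a matrix in $\mathrm{GL}_2(K)$;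 $\mathbb P(R)$ with the $K$-chains is the \emph{generalized chain geometry} $\Sigma(K,R)$, called a \emph{chain geometry} if $K$ lies in the centre of $R$, and called \emph{disconnected} if $\mathbb P(R)$ is disconnected. A \emph{$K$-ring with a degree function} is a ring $R$ such that $K=R^*\cup\{0\}$ is a field, together with a function $\deg:R\to\{-\infty\}\cup\{0,1,2,\dots\}$ such that for all $a,b\in R$: $\deg a=-\infty$ iff $a=0$; $\deg a=0$ iff $a\in R^*$; $\deg(a+b)\le\max\{\deg a,\deg b\}$; $\deg(ab)=\deg a+\deg b$. A row $(a_1,\dots,a_n)$ over $R$ is \emph{unimodular} if $\sum a_ix_i=1$ for some $x_i\in R$; $R$ has \emph{stable rank} $k$ if $k$ is the least positive integer such that for each unimodular row $(a_1,\dots,a_k)$ there are $b_1,\dots,b_{k-1}\in R$ with $(a_1+a_kb_1,\dots,a_{k-1}+a_kb_{k-1})$ unimodular. (a) Let $R$ be a $K$-ring with a degree function such that $R\ne K$. Then every connected component of $\mathbb P(R)$ has infinite diameter, and any two distant points of $\mathbb P(R)$ are joined by a unique $K$-chain of $\Sigma(K,R)$. (b) Let $K[X]$ be the polynomial ring over a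 field $K$ in a central indeterminate. Then $\mathbb P(K[X])$ is connected and its diameter is infinite. If $K$ is commutative, then $K[X]$ has stable rank $3$. (c) Let $R=K[X_1,\dots,X_m]$ be the polynomial ring over a field $K$ in $m>1$ independent central indeterminates. Then: 1. There is a matrix $A\in\mathrm{GL}_2(R)$ with $$A^n=\begin{pmatrix}1+nX_1X_2&nX_1^2\\-nX_2^2&1-nX_1X_2\end{pmatrix}\quad\text{for all } n\in\mathbb Z,$$ $A^n\notin\mathrm{GE}_2(R)$ for all $n\in\mathbb Z$ not divisible by $\operatorname{char}K$ (i.e. for all $n\neq 0$ if $\operatorname{char}K=0$), and $A^{-1}B_{12}(1)A\notin\mathrm{GE}_2(R)$, $AB_{12}(1)A^{-1}\notin\mathrm{GE}_2(R)$. Neither $\mathrm E_2(R)$ nor $\mathrm{GE}_2(R)$ is normal in $\mathrm{GL}_2(R)$. 2. $\mathbb P(R)$ is not connected. The set of its connected components is in bijection with the set of right cosets of $\mathrm{GE}_2(R)$ in $\mathrm{GL}_2(R)$. The number of components is infinite if $\operatorname{char}K=0$, at least $\operatorname{char}K$ if $\operatorname{char}K>0$, and at least three if $\operatorname{char}K=2$.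 All components have infinite diameter. 3. $\Sigma(K,R)$ is a disconnected generalized chain geometry; if $K$ is commutative, it is a disconnected chain geometry. -/

import Mathlib

open scoped Matrix

universe u v w

namespace ProjLine

section Line

variable (R : Type u) [Ring R]

/-- The group of invertible `2 × 2` matrices over a (not necessarily commutative) ring. -/
abbrev GL2 : Type u := (Matrix (Fin 2) (Fin 2) R)ˣ

variable {R} in
/-- The cyclic submodule `R(a,b)` of the free left module `R²` spanned by row `i` of `g`. -/
def rowSpan (g : GL2 R) (i : Fin 2) : Submodule R (Fin 2 → R) :=
  Submodule.span R {(g : Matrix (Fin 2) (Fin 2) R) i}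

/-- The projective line over `R`: the submodules `R(a,b)` with `(a,b)` admissible, i.e. the first
row of an invertible matrix. This is the orbit of `R(1,0)` under `GL₂(R)` acting from the right
on row vectors. -/
def Point : Type u := {p : Submodule R (Fin 2 → R) // ∃ g : GL2 R, p = rowSpan g 0}

variable {R}

/-- The point `R(1,0)^g`, i.e. the point spanned by the first row of `g`. -/
def Point.mk (g : GL2 R) : Point R := ⟨rowSpan g 0, g, rfl⟩

/-- The distant relation: the orbit of the pair `(R(1,0), R(0,1))` under `GL₂(R)`. -/
def Distant (p q : Point R) : Prop :=
  ∃ g : GL2 R, p.1 = rowSpan g 0 ∧ q.1 = rowSpan g 1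

theorem Distant.symm {p q : Point R} (h : Distant p q) : Distant q p := by
  obtain ⟨g, hp, hq⟩ := h
  have hs : (!![0, 1; 1, 0] : Matrix (Fin 2) (Fin 2) R) * !![0, 1; 1, 0] = 1 := by
    simp [Matrix.one_fin_two]
  let s : GL2 R := ⟨!![0, 1; 1, 0], !![0, 1; 1, 0], hs, hs⟩
  refine ⟨s * g, ?_, ?_⟩
  · rw [hq]
    simp only [rowSpan]
    congr 2
    ext j
    simp [s, Matrix.mul_apply, Fin.sum_univ_two]
  · rw [hp]
    simp only [rowSpan]
    congr 2
    ext j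
    simp [s, Matrix.mul_apply, Fin.sum_univ_two]

variable (R) in
/-- The distant graph: its vertices are the points of the projective line, its edges are the
unordered pairs of (different) distant points. -/
def distantGraph : SimpleGraph (Point R) where
  Adj p q := p ≠ q ∧ Distant p q
  symm := ⟨fun _ _ h => ⟨h.1.symm, h.2.symm⟩⟩
  loopless := ⟨fun _ h => h.1 rfl⟩

/-- The diameter of a connected component: the supremum (in `ℕ ∪ {∞}`) of the distances between
its points. -/
noncomputable def componentDiam {V : Type u} (G : SimpleGraph V) (c : G.ConnectedComponent) : ℕ∞ :=
  ⨆ p ∈ c.supp, ⨆ q ∈ c.supp, G.edist p q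

/-- The elementary matrix `B₁₂(t)`. -/
def B12 (t : R) : GL2 R :=
  ⟨!![1, t; 0, 1], !![1, -t; 0, 1], by simp [Matrix.one_fin_two],
    by simp [Matrix.one_fin_two]⟩

/-- The elementary matrix `B₂₁(t)`. -/
def B21 (t : R) : GL2 R :=
  ⟨!![1, 0; t, 1], !![1, 0; -t, 1], by simp [Matrix.one_fin_two],
    by simp [Matrix.one_fin_two]⟩

variable (R) in
/-- The elementary subgroup `E₂(R)`. -/
def E2 : Subgroup (GL2 R) := Subgroup.closure (Set.range B12 ∪ Set.range B21)

variable (R) in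
/-- The subgroup `GE₂(R)` generated by `E₂(R)` and the invertible diagonal matrices. -/
def GE2 : Subgroup (GL2 R) :=
  Subgroup.closure ((E2 R : Set (GL2 R)) ∪
    {g | ∃ a b : Rˣ, (g : Matrix (Fin 2) (Fin 2) R) = !![(a : R), 0; 0, (b : R)]})

end Line

section ChainGeometry

variable {R : Type u} [Ring R]

/-- The subring `K` of `R` is a (not necessarily commutative) field. -/
structure IsSkewSubfield (K : Subring R) : Prop where
  zero_ne_one : (0 : R) ≠ 1
  exists_inv : ∀ a ∈ K, a ≠ 0 → ∃ b ∈ K, a * b = 1 ∧ b * a = 1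

/-- The embedding of `GL₂(K)` into `GL₂(R)` for a subring `K` of `R`. -/
def GL2.ofSubring (K : Subring R) : GL2 K →* GL2 R :=
  Units.map (K.subtype.mapMatrix : Matrix (Fin 2) (Fin 2) K →+* Matrix (Fin 2) (Fin 2) R).toMonoidHom

/-- The `K`-chains (`K`-sublines) of the projective line over `R`: the images under `GL₂(R)` of
the projective line over `K`, embedded by `K(a,b) ↦ R(a,b)`. They are the blocks of the
generalized chain geometry `Σ(K,R)`, whose points are the points of the projective line. -/
def chains (K : Subring R) : Set (Set (Point R)) :=
  {C | ∃ g : GL2 R, C = {p | ∃ h : GL2 K, p = Point.mk (GL2.ofSubring K h * g)}}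

/-- `Σ(K,R)` is a disconnected generalized chain geometry: `K` is a (not necessarily commutative)
subfield of `R` and the projective line over `R` is disconnected. -/
def IsDisconnectedGeneralizedChainGeometry (K : Subring R) : Prop :=
  IsSkewSubfield K ∧ ¬ (distantGraph R).Connected

/-- `Σ(K,R)` is a disconnected (ordinary) chain geometry: in addition, `K` lies in the centre. -/
def IsDisconnectedChainGeometry (K : Subring R) : Prop :=
  IsDisconnectedGeneralizedChainGeometry K ∧ K ≤ Subring.center R

/-- `R` is a `K`-ring with the degree function `deg`: the set `K = Rˣ ∪ {0}` is a (not necessarily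
commutative) field, and `deg : R → {-∞} ∪ ℕ` satisfies the axioms below. -/
structure IsKRingWithDegree (K : Subring R) (deg : R → WithBot ℕ) : Prop where
  isSkewSubfield : IsSkewSubfield K
  mem_iff : ∀ a, a ∈ K ↔ IsUnit a ∨ a = 0
  deg_eq_bot : ∀ a, deg a = ⊥ ↔ a = 0
  deg_eq_zero : ∀ a, deg a = 0 ↔ IsUnit a
  deg_add : ∀ a b, deg (a + b) ≤ max (deg a) (deg b)
  deg_mul : ∀ a b, deg (a * b) = deg a + deg b

end ChainGeometry

section StableRank

variable (R : Type u) [Ring R]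

variable {R} in
/-- Unimodular rows. -/
def Unimodular {n : ℕ} (a : Fin n → R) : Prop := ∃ x : Fin n → R, ∑ i, a i * x i = 1

/-- Every unimodular row of length `n + 1` can be shortened to one of length `n` by adding right
multiples of its last entry to the other entries. -/
def RowsShorten (n : ℕ) : Prop :=
  ∀ a : Fin (n + 1) → R, Unimodular a →
    ∃ b : Fin n → R, Unimodular (fun i : Fin n => a i.castSucc + a (Fin.last n) * b i)

/-- `R` has stable rank `k`, in the normalization in which local rings have stable rank at
most `2`: `k` is the least positive length of rows for which all unimodular rows can be
shortened. -/
def HasStableRank (k : ℕ) : Prop := IsLeast {l | ∃ n, l = n + 1 ∧ RowsShorten R n} k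

end StableRank

section Polynomials

variable (K : Type u) [DivisionRing K] (m : ℕ)

/-- The polynomial ring `K[X₁,…,Xₘ]` in independent central indeterminates over a not necessarily
commutative field `K` (Mathlib's `MvPolynomial` needs commutative coefficients). -/
abbrev CentralPoly : Type u := AddMonoidAlgebra K (Fin m →₀ ℕ)

variable {m} in
/-- The indeterminate with index `i`. -/
noncomputable def var (i : Fin m) : CentralPoly K m := AddMonoidAlgebra.single (Finsupp.single i 1) 1

/-- The constant polynomials, as a subring of `K[X₁,…,Xₘ]`. -/
noncomputable def constants : Subring (CentralPoly K m) :=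
  (AddMonoidAlgebra.singleZeroRingHom : K →+* CentralPoly K m).range

end Polynomials

end ProjLine

open ProjLine

/-!
Every point of the projective line is the span of the first row of some `g ∈ GL₂(R)`, and the
points distant from it are spanned by `t v + w`, where `v, w` are the rows of `g`
(`distant_mk_iff`). One step of a path is thus left multiplication by `pivot t ∈ GE₂(R)`, so that
the components are the right cosets of `GE₂(R)` (`reachable_mk_iff`, `cosetEquivComponent`).

Let `R` have a degree function. In a shortest path with steps `pivot t`, a coefficient `t` of an
inner step is neither `0` nor a unit, since otherwise the path could be shortened. Hence the degree
of the second coordinate increases along the path (`IsKRingWithDegree.exists_rep_of_edist`).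
Conversely, a point has at most one neighbour with a second coordinate of smaller degree, so the
powers of `pivot x`, for a nonunit `x ≠ 0`, lead to points at any prescribed distance
(`edist_eq_add_one`, `edist_mk_pivot_pow`): all diameters are infinite. The same induction shows
that the first row `(a, b)` of a matrix in `GE₂(R)`, if `b ≠ 0`, satisfies `deg (a - b t) < deg b`
for some `t` (`exists_deg_sub_lt_of_mem_GE2`). The chain through two distant points is unique since
the matrices fixing both points are diagonal, and their entries are units of `R`, hence in `K`.

For one indeterminate, the Euclidean algorithm gives `GE₂(K[X]) = GL₂(K[X])`. The stable rank of
`K[X]` is at most `3` as in every principal ideal domain, and `(X, 1 - X²)` cannot be shortened.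

For several indeterminates, the total degree is a degree function, and the division condition fails
for the powers of the matrix `A = 1 + N` with `N² = 0` (`cohnMatrix_notMem_GE2`) and for the
conjugates of `B₁₂(1)` by `A` and `A⁻¹` (`cohnMatrix_conj_notMem_GE2`). So the powers of `A` whose
exponents differ modulo the characteristic lie in different cosets, and so do `1`, `A` and
`A B₁₂(1)`.
-/

namespace ProjLine

/-! ### Points, distant points and lower triangular matrices -/

section General

variable {R : Type u} [Ring R]

/-- The invertible lower triangular matrix with diagonal `(a, d)` and lower left entry `s`. Left
multiplication by these matrices is exactly what does not change the point `Point.mk g`. -/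
def lowerTri (a : Rˣ) (s : R) (d : Rˣ) : GL2 R :=
  ⟨!![(a : R), 0; s, (d : R)],
    !![((a⁻¹ : Rˣ) : R), 0; -((d⁻¹ : Rˣ) : R) * s * ((a⁻¹ : Rˣ) : R), ((d⁻¹ : Rˣ) : R)],
    by simp [Matrix.one_fin_two, mul_assoc], by simp [Matrix.one_fin_two, mul_assoc]⟩

/-- The matrix with rows `(t, 1)` and `(1, 0)`: left multiplication turns the rows `v, w` of a
matrix into `t v + w, v`, which is one step of a path in the distant graph. -/
def pivot (t : R) : GL2 R :=
  ⟨!![t, 1; 1, 0], !![0, 1; 1, -t], by simp [Matrix.one_fin_two], by simp [Matrix.one_fin_two]⟩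

@[simp] theorem val_lowerTri (a : Rˣ) (s : R) (d : Rˣ) :
    (lowerTri a s d : Matrix (Fin 2) (Fin 2) R) = !![(a : R), 0; s, (d : R)] := rfl

@[simp] theorem val_pivot (t : R) :
    (pivot t : Matrix (Fin 2) (Fin 2) R) = !![t, 1; 1, 0] := rfl

@[simp] theorem val_B12 (t : R) :
    (B12 t : Matrix (Fin 2) (Fin 2) R) = !![1, t; 0, 1] := rfl

@[simp] theorem val_B21 (t : R) :
    (B21 t : Matrix (Fin 2) (Fin 2) R) = !![1, 0; t, 1] := rfl

theorem mul_row_zero (g h : GL2 R) (j : Fin 2) :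
    (g * h : GL2 R).val 0 j = g.val 0 0 * h.val 0 j + g.val 0 1 * h.val 1 j := by
  simp [Matrix.mul_apply, Fin.sum_univ_two]

theorem mul_row_one (g h : GL2 R) (j : Fin 2) :
    (g * h : GL2 R).val 1 j = g.val 1 0 * h.val 0 j + g.val 1 1 * h.val 1 j := by
  simp [Matrix.mul_apply, Fin.sum_univ_two]

theorem B21_eq_lowerTri (t : R) : B21 t = lowerTri 1 t 1 := by
  ext i j; fin_cases i <;> fin_cases j <;> simp

theorem pivot_eq_B12_mul (t : R) : pivot t = B12 t * pivot 0 := by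
  ext i j; fin_cases i <;> fin_cases j <;> simp

theorem pivot_zero_mul_pivot (t : R) : pivot 0 * pivot t = B21 t := by
  ext i j; fin_cases i <;> fin_cases j <;> simp

theorem mk_lowerTri_mul (a : Rˣ) (s : R) (d : Rˣ) (g : GL2 R) :
    Point.mk (lowerTri a s d * g) = Point.mk g := by
  apply Subtype.ext
  have h : (lowerTri a s d * g : GL2 R).val 0 = a • g.val 0 := by
    ext j; simp [mul_row_zero, Units.smul_def]
  simp only [Point.mk, rowSpan, h]
  exact Submodule.span_singleton_group_smul_eq R a _

theorem mk_B21_mul (t : R) (g : GL2 R) : Point.mk (B21 t * g) = Point.mk g := by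
  rw [B21_eq_lowerTri, mk_lowerTri_mul]

theorem mk_surjective (p : Point R) : ∃ g, p = Point.mk g := by
  obtain ⟨p, g, h⟩ := p
  exact ⟨g, Subtype.ext h⟩

theorem exists_eq_lowerTri_of_first_row {k : GL2 R} (h : k.val 0 1 = 0)
    (h' : (k⁻¹ : GL2 R).val 0 1 = 0) : ∃ a s d, k = lowerTri a s d := by
  have e (i j : Fin 2) : (k * k⁻¹ : GL2 R).val i j = (1 : Matrix (Fin 2) (Fin 2) R) i j := by simp
  have e' (i j : Fin 2) : (k⁻¹ * k : GL2 R).val i j = (1 : Matrix (Fin 2) (Fin 2) R) i j := by simp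
  have e00 := e 0 0
  have e11 := e 1 1
  have f00 := e' 0 0
  have f11 := e' 1 1
  rw [mul_row_zero, h] at e00
  rw [mul_row_zero, h'] at f00
  rw [mul_row_one, h'] at e11
  rw [mul_row_one, h] at f11
  refine ⟨⟨k.val 0 0, (k⁻¹ : GL2 R).val 0 0, by simpa using e00, by simpa using f00⟩, k.val 1 0,
    ⟨k.val 1 1, (k⁻¹ : GL2 R).val 1 1, by simpa using e11, by simpa using f11⟩, ?_⟩
  ext i j; fin_cases i <;> fin_cases j <;> simp [h]

theorem exists_eq_lowerTri_mul_of_mk_eq {g h : GL2 R} (e : Point.mk g = Point.mk h) :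
    ∃ a s d, g = lowerTri a s d * h := by
  have key : ∀ g h : GL2 R, Point.mk g = Point.mk h → (g * h⁻¹ : GL2 R).val 0 1 = 0 := by
    intro g h e
    have e' : rowSpan g 0 = rowSpan h 0 := congrArg Subtype.val e
    have hm : g.val 0 ∈ rowSpan h 0 := by
      rw [← e']; exact Submodule.mem_span_singleton_self _
    obtain ⟨c, hc⟩ := Submodule.mem_span_singleton.mp hm
    have h01 : (h * h⁻¹ : GL2 R).val 0 1 = 0 := by simp
    rw [mul_row_zero] at h01
    rw [mul_row_zero, ← hc]
    simp only [Pi.smul_apply, smul_eq_mul, mul_assoc, ← mul_add, h01, mul_zero]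
  obtain ⟨a, s, d, hk⟩ := exists_eq_lowerTri_of_first_row (key g h e)
    (by rw [mul_inv_rev, inv_inv]; exact key h g e.symm)
  exact ⟨a, s, d, by rw [← hk, inv_mul_cancel_right]⟩

theorem distant_iff_exists_mk {p q : Point R} :
    Distant p q ↔ ∃ g, p = Point.mk g ∧ q = Point.mk (pivot 0 * g) := by
  have h (g : GL2 R) : (Point.mk (pivot 0 * g)).1 = rowSpan g 1 := by
    simp only [Point.mk, rowSpan]
    congr 2
    ext j
    simp [mul_row_zero]
  constructor
  · rintro ⟨g, hp, hq⟩
    exact ⟨g, Subtype.ext hp, Subtype.ext (hq.trans (h g).symm)⟩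
  · rintro ⟨g, rfl, rfl⟩
    exact ⟨g, rfl, h g⟩

theorem pivot_zero_mul_lowerTri (a : Rˣ) (s : R) (d : Rˣ) :
    pivot 0 * lowerTri a s d = lowerTri d 0 a * pivot (↑d⁻¹ * s) := by
  ext i j; fin_cases i <;> fin_cases j <;> simp

/-- The points distant from the first row of `g` are those spanned by `t v + w`, where `v, w` are
the rows of `g`. -/
theorem distant_mk_iff {g : GL2 R} {q : Point R} :
    Distant (Point.mk g) q ↔ ∃ t, q = Point.mk (pivot t * g) := by
  rw [distant_iff_exists_mk]
  constructor
  · rintro ⟨g', h, rfl⟩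
    obtain ⟨a, s, d, rfl⟩ := exists_eq_lowerTri_mul_of_mk_eq h.symm
    refine ⟨↑d⁻¹ * s, ?_⟩
    rw [← mul_assoc, pivot_zero_mul_lowerTri, mul_assoc, mk_lowerTri_mul]
  · rintro ⟨t, rfl⟩
    refine ⟨B21 t * g, (mk_B21_mul t g).symm, ?_⟩
    rw [← mul_assoc]
    congr 2
    ext i j; fin_cases i <;> fin_cases j <;> simp

theorem mk_pivot_zero_mul_pivot_mul (t : R) (g : GL2 R) :
    Point.mk (pivot 0 * (pivot t * g)) = Point.mk g := by
  rw [← mul_assoc, pivot_zero_mul_pivot, mk_B21_mul]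

theorem mk_ne_mk_pivot_mul [Nontrivial R] (t : R) (g : GL2 R) :
    Point.mk g ≠ Point.mk (pivot t * g) := by
  intro h
  obtain ⟨a, s, d, e⟩ := exists_eq_lowerTri_mul_of_mk_eq h.symm
  have e' := congrArg (fun k : GL2 R => k.val 0 1) (mul_right_cancel e)
  simp at e'

theorem adj_mk_pivot_mul [Nontrivial R] (t : R) (g : GL2 R) :
    (distantGraph R).Adj (Point.mk g) (Point.mk (pivot t * g)) :=
  ⟨mk_ne_mk_pivot_mul t g, distant_mk_iff.mpr ⟨t, rfl⟩⟩

theorem Distant.ne [Nontrivial R] {p q : Point R} (h : Distant p q) : p ≠ q := by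
  obtain ⟨g, rfl⟩ := mk_surjective p
  obtain ⟨t, rfl⟩ := distant_mk_iff.mp h
  exact mk_ne_mk_pivot_mul t g

theorem reachable_mk_pivot_mul (t : R) (g : GL2 R) :
    (distantGraph R).Reachable (Point.mk g) (Point.mk (pivot t * g)) := by
  by_cases h : Point.mk g = Point.mk (pivot t * g)
  · rw [h]
  · exact SimpleGraph.Adj.reachable ⟨h, distant_mk_iff.mpr ⟨t, rfl⟩⟩

/-! ### Connected components and cosets of `GE₂(R)` -/

theorem B12_mem_GE2 (t : R) : B12 t ∈ GE2 R :=
  Subgroup.subset_closure (Or.inl (Subgroup.subset_closure (Or.inl ⟨t, rfl⟩)))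

theorem B21_mem_GE2 (t : R) : B21 t ∈ GE2 R :=
  Subgroup.subset_closure (Or.inl (Subgroup.subset_closure (Or.inr ⟨t, rfl⟩)))

theorem lowerTri_mem_GE2 (a : Rˣ) (s : R) (d : Rˣ) : lowerTri a s d ∈ GE2 R := by
  have h : lowerTri a s d = lowerTri a 0 d * B21 (↑d⁻¹ * s) := by
    ext i j; fin_cases i <;> fin_cases j <;> simp
  rw [h]
  exact mul_mem (Subgroup.subset_closure (Or.inr ⟨a, d, rfl⟩)) (B21_mem_GE2 _)

theorem pivot_mem_GE2 (t : R) : pivot t ∈ GE2 R := by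
  have h : pivot t = B12 t * (lowerTri 1 0 (-1) * (B12 1 * (B21 (-1) * B12 1))) := by
    ext i j; fin_cases i <;> fin_cases j <;> simp
  rw [h]
  exact mul_mem (B12_mem_GE2 _) (mul_mem (lowerTri_mem_GE2 _ _ _)
    (mul_mem (B12_mem_GE2 _) (mul_mem (B21_mem_GE2 _) (B12_mem_GE2 _))))

theorem reachable_mk_mul {k : GL2 R} (hk : k ∈ GE2 R) (g : GL2 R) :
    (distantGraph R).Reachable (Point.mk (k * g)) (Point.mk g) := by
  have hE : ∀ k ∈ E2 R, ∀ g : GL2 R,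
      (distantGraph R).Reachable (Point.mk (k * g)) (Point.mk g) := by
    intro k hk
    induction hk using Subgroup.closure_induction with
    | mem k hk =>
      intro g
      rcases hk with ⟨t, rfl⟩ | ⟨t, rfl⟩
      · -- both points are distant from the second row of `g`
        have h1 := reachable_mk_pivot_mul t (pivot 0 * g)
        have h2 := reachable_mk_pivot_mul 0 (pivot 0 * g)
        rw [← mul_assoc, pivot_eq_B12_mul t, mul_assoc (B12 t), pivot_zero_mul_pivot] at h1
        rw [← mul_assoc, pivot_zero_mul_pivot] at h2
        have e : B21 (0 : R) = 1 := by ext i j; fin_cases i <;> fin_cases j <;> simp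
        rw [e, one_mul] at h2
        rw [e, mul_one] at h1
        exact h1.symm.trans h2
      · rw [mk_B21_mul]
    | one => intro g; rw [one_mul]
    | mul x y _ _ hx hy => intro g; rw [mul_assoc]; exact (hx _).trans (hy g)
    | inv x _ hx => intro g; simpa using (hx (x⁻¹ * g)).symm
  revert g
  induction hk using Subgroup.closure_induction with
  | mem k hk =>
    intro g
    rcases hk with hk | ⟨a, d, h⟩
    · exact hE k hk g
    · rw [show k = lowerTri a 0 d from Units.ext h, mk_lowerTri_mul]
  | one => intro g; rw [one_mul]
  | mul x y _ _ hx hy => intro g; rw [mul_assoc]; exact (hx _).trans (hy g)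
  | inv x _ hx => intro g; simpa using (hx (x⁻¹ * g)).symm

theorem mul_inv_mem_GE2_of_reachable {p q : Point R} (h : (distantGraph R).Reachable p q) :
    ∀ g k : GL2 R, p = Point.mk g → q = Point.mk k → k * g⁻¹ ∈ GE2 R := by
  have base : ∀ g k : GL2 R, Point.mk g = Point.mk k → k * g⁻¹ ∈ GE2 R := by
    intro g k h
    obtain ⟨a, s, d, rfl⟩ := exists_eq_lowerTri_mul_of_mk_eq h.symm
    simpa using lowerTri_mem_GE2 a s d
  obtain ⟨W⟩ := h
  induction W with
  | nil => intro g k hg hk; exact base g k (hg.symm.trans hk)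
  | cons hadj _ ih =>
    intro g k hg hk
    subst hg
    obtain ⟨t, rfl⟩ := distant_mk_iff.mp hadj.2
    have := mul_mem (ih _ k rfl hk) (pivot_mem_GE2 t)
    simpa [mul_assoc] using this

/-- The connected components of the projective line are described by the right cosets of
`GE₂(R)`. -/
theorem reachable_mk_iff {g k : GL2 R} :
    (distantGraph R).Reachable (Point.mk g) (Point.mk k) ↔ k * g⁻¹ ∈ GE2 R := by
  refine ⟨fun h => mul_inv_mem_GE2_of_reachable h g k rfl rfl, fun h => ?_⟩
  simpa using (reachable_mk_mul h g).symm

variable (R) in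
/-- The bijection which maps the coset `GE₂(R) g` to the component of the point spanned by the
first row of `g`. -/
noncomputable def cosetEquivComponent :
    Quotient (QuotientGroup.rightRel (GE2 R)) ≃ (distantGraph R).ConnectedComponent :=
  Equiv.ofBijective
    (Quotient.lift (fun g => (distantGraph R).connectedComponentMk (Point.mk g)) (by
      intro g k h
      exact SimpleGraph.ConnectedComponent.eq.mpr
        (reachable_mk_iff.mpr (QuotientGroup.rightRel_apply.mp h)))) (by
    constructor
    · rintro ⟨g⟩ ⟨k⟩ h
      exact Quotient.sound (QuotientGroup.rightRel_apply.mpr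
        (reachable_mk_iff.mp (SimpleGraph.ConnectedComponent.eq.mp h)))
    · intro c
      induction c using SimpleGraph.ConnectedComponent.ind with
      | h p =>
        obtain ⟨g, rfl⟩ := mk_surjective p
        exact ⟨Quotient.mk _ g, rfl⟩)

theorem connected_iff : (distantGraph R).Connected ↔ GE2 R = ⊤ := by
  constructor
  · intro h
    refine (Subgroup.eq_top_iff' _).mpr fun g => ?_
    simpa using reachable_mk_iff.mp (h.preconnected (Point.mk 1) (Point.mk g))
  · intro h
    have : Nonempty (Point R) := ⟨Point.mk 1⟩
    refine SimpleGraph.Connected.mk fun p q => ?_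
    obtain ⟨g, rfl⟩ := mk_surjective p
    obtain ⟨k, rfl⟩ := mk_surjective q
    exact reachable_mk_iff.mpr (h ▸ Subgroup.mem_top _)

theorem connectedComponentMk_eq_iff {g k : GL2 R} :
    (distantGraph R).connectedComponentMk (Point.mk g) =
      (distantGraph R).connectedComponentMk (Point.mk k) ↔ k * g⁻¹ ∈ GE2 R :=
  SimpleGraph.ConnectedComponent.eq.trans reachable_mk_iff

end General

/-! ### Rings with a degree function -/

theorem exists_adj_of_edist_eq_add_one {V : Type u} {G : SimpleGraph V} {a c : V} {n : ℕ}
    (h : G.edist a c = n + 1) : ∃ b, G.edist a b = n ∧ G.Adj b c := by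
  obtain ⟨W, hW⟩ := G.exists_walk_of_edist_eq_coe (k := n + 1) (by exact_mod_cast h)
  have hn : ¬ W.Nil := by rw [← SimpleGraph.Walk.length_eq_zero_iff]; omega
  have hadj := W.adj_penultimate hn
  refine ⟨W.penultimate, le_antisymm ?_ ?_, hadj⟩
  · refine (G.edist_le W.dropLast).trans ?_
    rw [SimpleGraph.Walk.length_dropLast]
    exact_mod_cast (by omega : W.length - 1 ≤ n)
  · have h3 := G.edist_triangle (u := a) (v := W.penultimate) (w := c)
    rw [h, SimpleGraph.edist_eq_one_iff_adj.mpr hadj] at h3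
    exact (ENat.add_le_add_iff_right (by simp)).mp h3

theorem lt_add_of_pos_of_ne_bot {x y : WithBot ℕ} (hx : x ≠ ⊥) (hy : 0 < y) : x < y + x := by
  cases x with
  | bot => exact absurd rfl hx
  | coe x =>
    cases y with
    | bot => simp at hy
    | coe y =>
      have hy' : 0 < y := WithBot.coe_pos.mp hy
      exact_mod_cast (by omega : x < y + x)

theorem add_lt_add_of_lt_of_ne_bot {x y z : WithBot ℕ} (h : x < y) (hz : z ≠ ⊥) :
    z + x < z + y := by
  cases z with
  | bot => exact absurd rfl hz
  | coe z =>
    cases y with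
    | bot => simp at h
    | coe y =>
      cases x with
      | bot => simp
      | coe x =>
        have h' : x < y := by exact_mod_cast h
        exact_mod_cast (by omega : z + x < z + y)

namespace IsKRingWithDegree

variable {R : Type u} [Ring R] {K : Subring R} {deg : R → WithBot ℕ}

theorem nontrivial (h : IsKRingWithDegree K deg) : Nontrivial R :=
  ⟨0, 1, h.isSkewSubfield.zero_ne_one⟩

theorem deg_zero (h : IsKRingWithDegree K deg) : deg 0 = ⊥ := (h.deg_eq_bot 0).mpr rfl

theorem deg_one (h : IsKRingWithDegree K deg) : deg 1 = 0 := (h.deg_eq_zero 1).mpr isUnit_one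

theorem deg_ne_bot (h : IsKRingWithDegree K deg) {a : R} (ha : a ≠ 0) : deg a ≠ ⊥ :=
  mt (h.deg_eq_bot a).mp ha

theorem deg_units_mul (h : IsKRingWithDegree K deg) (a : Rˣ) (b : R) : deg (a * b) = deg b := by
  rw [h.deg_mul, (h.deg_eq_zero _).mpr a.isUnit, zero_add]

theorem deg_neg (h : IsKRingWithDegree K deg) (a : R) : deg (-a) = deg a := by
  simpa using h.deg_units_mul (-1) a

theorem deg_pos (h : IsKRingWithDegree K deg) {a : R} (ha : a ≠ 0) (hu : ¬ IsUnit a) :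
    0 < deg a := by
  have h1 := h.deg_ne_bot ha
  have h2 := mt (h.deg_eq_zero a).mp hu
  generalize deg a = x at h1 h2
  cases x with
  | bot => exact absurd rfl h1
  | coe x =>
    exact WithBot.coe_pos.mpr (Nat.pos_of_ne_zero fun h3 => h2 (by rw [h3]; rfl))

theorem deg_sub (h : IsKRingWithDegree K deg) (a b : R) : deg (a - b) ≤ max (deg a) (deg b) := by
  rw [sub_eq_add_neg, ← h.deg_neg b]
  exact h.deg_add _ _

theorem deg_add_eq_left (h : IsKRingWithDegree K deg) {a b : R} (hlt : deg b < deg a) :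
    deg (a + b) = deg a := by
  refine le_antisymm ((h.deg_add a b).trans (by simp [hlt.le])) ?_
  have h1 := h.deg_sub (a + b) b
  rw [add_sub_cancel_right] at h1
  rcases le_max_iff.mp h1 with h2 | h2
  · exact h2
  · exact absurd h2 hlt.not_ge

/-- A point at distance `n + 1` from a base point has a representation by a matrix (relative to
the base point) whose second row is the preceding point of a shortest path. The degrees in the
second column increase along the path since the coefficients `t` of its inner steps can be neither
`0` nor units: otherwise the path could be shortened. The last two conditions say that subtracting
a right multiple of the second column makes the first column small. -/
theorem exists_rep_of_edist (hd : IsKRingWithDegree K deg) (g₀ : GL2 R) (n : ℕ) :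
    ∀ q : Point R, (distantGraph R).edist (Point.mk g₀) q = n + 1 → ∃ (g : GL2 R) (t : R),
      q = Point.mk (g * g₀) ∧
      (distantGraph R).edist (Point.mk g₀) (Point.mk (pivot 0 * (g * g₀))) = n ∧
      deg (g.val 1 1) < deg (g.val 0 1) ∧
      deg (g.val 0 0 - g.val 0 1 * t) < deg (g.val 0 1) ∧
      deg (g.val 1 0 - g.val 1 1 * t) ≤ deg (g.val 0 1) := by
  have := hd.nontrivial
  induction n with
  | zero =>
    intro q hq
    have hadj : (distantGraph R).Adj (Point.mk g₀) q := by
      rw [← SimpleGraph.edist_eq_one_iff_adj, hq]; simp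
    obtain ⟨t, rfl⟩ := distant_mk_iff.mp hadj.2
    refine ⟨pivot t, t, rfl, ?_, ?_⟩
    · rw [mk_pivot_zero_mul_pivot_mul]; simp
    · simp [hd.deg_zero, hd.deg_one]
  | succ n ih =>
    intro q hq
    obtain ⟨q', hq', hadj⟩ := exists_adj_of_edist_eq_add_one hq
    obtain ⟨g, t, rfl, hw, h1, h2, h3⟩ := ih q' (by simpa using hq')
    obtain ⟨α, rfl⟩ := distant_mk_iff.mp hadj.2
    have hα0 : α ≠ 0 := by
      rintro rfl
      rw [hw] at hq
      have : n = n + 1 + 1 := by exact_mod_cast hq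
      omega
    have hαu : ¬ IsUnit α := by
      rintro ⟨a, rfl⟩
      -- for a unit `a`, the vector `a v + w` is distant from `w`
      have e : pivot (a : R) * (g * g₀) =
          lowerTri a 1 (-a⁻¹) * (pivot (↑a⁻¹ : R) * (pivot 0 * (g * g₀))) := by
        simp only [← mul_assoc]
        congr 2
        ext i j; fin_cases i <;> fin_cases j <;> simp
      rw [e, mk_lowerTri_mul] at hq
      have h4 := (distantGraph R).edist_triangle (u := Point.mk g₀)
        (v := Point.mk (pivot 0 * (g * g₀)))
        (w := Point.mk (pivot (↑a⁻¹ : R) * (pivot 0 * (g * g₀))))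
      rw [hq, hw, SimpleGraph.edist_eq_one_iff_adj.mpr (adj_mk_pivot_mul _ _)] at h4
      have : n + 1 + 1 ≤ n + 1 := by exact_mod_cast h4
      omega
    have hpos := hd.deg_pos hα0 hαu
    have hb : g.val 0 1 ≠ 0 := by
      intro h
      rw [h, hd.deg_zero] at h1
      simp at h1
    have hlt : deg (g.val 0 1) < deg (α * g.val 0 1) := by
      rw [hd.deg_mul]
      exact lt_add_of_pos_of_ne_bot (hd.deg_ne_bot hb) hpos
    have hdeg : deg ((pivot α * g).val 0 1) = deg (α * g.val 0 1) := by
      rw [mul_row_zero]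
      simpa using hd.deg_add_eq_left (h1.trans hlt)
    refine ⟨pivot α * g, t, by rw [mul_assoc], ?_, ?_, ?_, ?_⟩
    · rw [mul_assoc, mk_pivot_zero_mul_pivot_mul, hq']
    · rw [hdeg, mul_row_one]
      simpa using hlt
    · have e : (pivot α * g).val 0 0 - (pivot α * g).val 0 1 * t =
          α * (g.val 0 0 - g.val 0 1 * t) + (g.val 1 0 - g.val 1 1 * t) := by
        simp only [mul_row_zero, val_pivot]
        simp
        noncomm_ring
      rw [hdeg, e]
      refine (hd.deg_add _ _).trans_lt (max_lt ?_ (h3.trans_lt hlt))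
      rw [hd.deg_mul, hd.deg_mul]
      exact add_lt_add_of_lt_of_ne_bot h2 (hd.deg_ne_bot hα0)
    · rw [hdeg, mul_row_one, mul_row_one]
      simpa using (h2.trans hlt).le

/-- A point with nonzero second coordinate has only one neighbour whose second coordinate has
smaller degree, so this neighbour is the last but one point of every shortest path. -/
theorem edist_eq_add_one (hd : IsKRingWithDegree K deg) {g₀ g : GL2 R}
    (hfin : (distantGraph R).edist (Point.mk g₀) (Point.mk (g * g₀)) ≠ ⊤)
    (h : deg (g.val 1 1) < deg (g.val 0 1)) :
    (distantGraph R).edist (Point.mk g₀) (Point.mk (g * g₀)) =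
      (distantGraph R).edist (Point.mk g₀) (Point.mk (pivot 0 * (g * g₀))) + 1 := by
  have := hd.nontrivial
  obtain ⟨k, hk⟩ := ENat.ne_top_iff_exists.mp hfin
  have hb : g.val 0 1 ≠ 0 := by
    intro h'
    rw [h', hd.deg_zero] at h
    simp at h
  cases k with
  | zero =>
    exfalso
    have h0 := SimpleGraph.edist_eq_zero_iff.mp hk.symm
    obtain ⟨a, s, d, e⟩ := exists_eq_lowerTri_mul_of_mk_eq h0.symm
    rw [mul_right_cancel e] at hb
    simp at hb
  | succ n =>
    obtain ⟨g', t, e, hw, h1, -⟩ := hd.exists_rep_of_edist g₀ n _ (by rw [← hk]; simp)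
    obtain ⟨a, s, d, e'⟩ := exists_eq_lowerTri_mul_of_mk_eq e.symm
    rw [← mul_assoc] at e'
    obtain rfl := mul_right_cancel e'
    have hs : s = 0 := by
      by_contra hs
      rw [mul_row_one, mul_row_zero] at h1
      simp only [val_lowerTri, Matrix.cons_val', Matrix.cons_val_zero, Matrix.cons_val_fin_one,
        Matrix.cons_val_one, zero_mul, add_zero, Matrix.of_apply] at h1
      have h2 : deg (g.val 0 1) ≤ deg (s * g.val 0 1) := by
        rw [hd.deg_mul]
        by_cases hu : IsUnit s
        · rw [(hd.deg_eq_zero s).mpr hu, zero_add]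
        · exact (lt_add_of_pos_of_ne_bot (hd.deg_ne_bot hb) (hd.deg_pos hs hu)).le
      rw [hd.deg_add_eq_left (by rw [hd.deg_units_mul]; exact h.trans_le h2),
        hd.deg_units_mul] at h1
      exact h1.not_ge h2
    subst hs
    have e2 : pivot 0 * (lowerTri a 0 d * g * g₀) = lowerTri d 0 a * (pivot 0 * (g * g₀)) := by
      simp only [← mul_assoc]
      congr 2
      ext i j; fin_cases i <;> fin_cases j <;> simp
    rw [e2, mk_lowerTri_mul] at hw
    rw [hw, ← hk]
    simp

theorem edist_mk_pivot_pow (hd : IsKRingWithDegree K deg) {x : R} (hx : x ≠ 0)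
    (hxu : ¬ IsUnit x) (g₀ : GL2 R) (n : ℕ) :
    (distantGraph R).edist (Point.mk g₀) (Point.mk (pivot x ^ n * g₀)) = n := by
  have := hd.nontrivial
  have hdeg : ∀ n : ℕ, deg ((pivot x ^ (n + 1)).val 1 1) < deg ((pivot x ^ (n + 1)).val 0 1) := by
    intro n
    induction n with
    | zero => simp [hd.deg_zero, hd.deg_one]
    | succ n ih =>
      rw [pow_succ' _ (n + 1), mul_row_zero, mul_row_one]
      have hb : (pivot x ^ (n + 1)).val 0 1 ≠ 0 := by
        intro h'
        rw [h', hd.deg_zero] at ih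
        simp at ih
      have hlt : deg ((pivot x ^ (n + 1)).val 0 1) < deg (x * (pivot x ^ (n + 1)).val 0 1) := by
        rw [hd.deg_mul]
        exact lt_add_of_pos_of_ne_bot (hd.deg_ne_bot hb) (hd.deg_pos hx hxu)
      have e := hd.deg_add_eq_left (ih.trans hlt)
      simp only [val_pivot, Matrix.cons_val', Matrix.cons_val_zero, Matrix.cons_val_fin_one,
        Matrix.cons_val_one, one_mul, zero_mul, add_zero, Matrix.of_apply]
      rw [e]
      exact hlt
  induction n with
  | zero => simp
  | succ n ih =>
    have hp : Point.mk (pivot 0 * (pivot x ^ (n + 1) * g₀)) = Point.mk (pivot x ^ n * g₀) := by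
      rw [pow_succ', mul_assoc (pivot x), mk_pivot_zero_mul_pivot_mul]
    have hfin : (distantGraph R).edist (Point.mk g₀) (Point.mk (pivot x ^ (n + 1) * g₀)) ≠ ⊤ := by
      rw [SimpleGraph.edist_ne_top_iff_reachable]
      exact (reachable_mk_mul (pow_mem (pivot_mem_GE2 x) _) g₀).symm
    rw [hd.edist_eq_add_one hfin (hdeg n), hp, ih]
    simp

theorem exists_ne_zero_not_isUnit (hd : IsKRingWithDegree K deg) (hK : K ≠ ⊤) :
    ∃ x : R, x ≠ 0 ∧ ¬ IsUnit x := by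
  by_contra! h
  exact hK (eq_top_iff.mpr fun x _ => (hd.mem_iff x).mpr (by
    by_cases hx : x = 0
    · exact Or.inr hx
    · exact Or.inl (h x hx)))

theorem componentDiam_eq_top (hd : IsKRingWithDegree K deg) (hK : K ≠ ⊤)
    (c : (distantGraph R).ConnectedComponent) : componentDiam (distantGraph R) c = ⊤ := by
  obtain ⟨x, hx, hxu⟩ := hd.exists_ne_zero_not_isUnit hK
  induction c using SimpleGraph.ConnectedComponent.ind with
  | h p =>
    obtain ⟨g, rfl⟩ := mk_surjective p
    rw [ENat.eq_top_iff_forall_ge]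
    intro n
    rw [← hd.edist_mk_pivot_pow hx hxu g n]
    have hmem : Point.mk (pivot x ^ n * g) ∈
        ((distantGraph R).connectedComponentMk (Point.mk g)).supp :=
      SimpleGraph.ConnectedComponent.eq.mpr (reachable_mk_mul (pow_mem (pivot_mem_GE2 x) _) g)
    exact le_iSup₂_of_le (Point.mk g) rfl
      (le_iSup₂_of_le (f := fun q _ => (distantGraph R).edist (Point.mk g) q) _ hmem le_rfl)

/-- Necessary condition for a matrix to lie in `GE₂(R)`: its first row can be reduced by one
division step. -/
theorem exists_deg_sub_lt_of_mem_GE2 (hd : IsKRingWithDegree K deg) {g : GL2 R} (hg : g ∈ GE2 R)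
    (hb : g.val 0 1 ≠ 0) : ∃ t, deg (g.val 0 0 - g.val 0 1 * t) < deg (g.val 0 1) := by
  have hr : (distantGraph R).Reachable (Point.mk 1) (Point.mk g) :=
    reachable_mk_iff.mpr (by simpa using hg)
  obtain ⟨k, hk⟩ := ENat.ne_top_iff_exists.mp (SimpleGraph.edist_ne_top_iff_reachable.mpr hr)
  cases k with
  | zero =>
    exfalso
    have h0 := SimpleGraph.edist_eq_zero_iff.mp hk.symm
    obtain ⟨a, s, d, e⟩ := exists_eq_lowerTri_mul_of_mk_eq h0.symm
    rw [e] at hb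
    simp at hb
  | succ n =>
    obtain ⟨g', t, e, -, -, h2, -⟩ := hd.exists_rep_of_edist 1 n _ (by rw [← hk]; simp)
    rw [mul_one] at e
    obtain ⟨a, s, d, rfl⟩ := exists_eq_lowerTri_mul_of_mk_eq e
    refine ⟨t, ?_⟩
    simp only [mul_row_zero, val_lowerTri, Matrix.cons_val', Matrix.cons_val_zero,
      Matrix.cons_val_fin_one, Matrix.cons_val_one, zero_mul, add_zero, Matrix.of_apply]
    rw [mul_assoc, ← mul_sub, hd.deg_units_mul, hd.deg_units_mul]
    exact h2

end IsKRingWithDegree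

/-! ### Chains through two distant points -/

section Chains

variable {R : Type u} [Ring R]

theorem mk_eq_mk_of_row {g h : GL2 R} (e : g.val 0 = h.val 0) : Point.mk g = Point.mk h :=
  Subtype.ext (by simp only [Point.mk, rowSpan, e])

theorem exists_eq_lowerTri_of_apply_eq_zero [Nontrivial R] [NoZeroDivisors R] {g : GL2 R}
    (h : g.val 0 1 = 0) : ∃ a s d, g = lowerTri a s d := by
  have e (j : Fin 2) : (g * g⁻¹ : GL2 R).val 0 j = (1 : Matrix (Fin 2) (Fin 2) R) 0 j := by simp
  have e0 := e 0
  have e1 := e 1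
  rw [mul_row_zero, h, zero_mul, add_zero] at e0 e1
  have hne : g.val 0 0 ≠ 0 := by
    intro h0
    rw [h0] at e0
    simp at e0
  exact exists_eq_lowerTri_of_first_row h ((mul_eq_zero.mp (e1.trans (by simp))).resolve_left hne)

theorem eq_of_mk_pivot_mul_eq {t t' : R} {g : GL2 R}
    (h : Point.mk (pivot t * g) = Point.mk (pivot t' * g)) : t = t' := by
  obtain ⟨a, s, d, e⟩ := exists_eq_lowerTri_mul_of_mk_eq h
  rw [← mul_assoc] at e
  have e' := mul_right_cancel e
  have e0 := congrArg (fun k : GL2 R => k.val 0 0) e'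
  have e1 := congrArg (fun k : GL2 R => k.val 0 1) e'
  simp at e0 e1
  rw [e0, ← e1, one_mul]

@[simp] theorem ofSubring_apply (K : Subring R) (h : GL2 K) (i j : Fin 2) :
    (GL2.ofSubring K h).val i j = (h.val i j : R) := rfl

theorem ofSubring_lowerTri (K : Subring R) (a : Kˣ) (s : K) (d : Kˣ) :
    GL2.ofSubring K (lowerTri a s d) =
      lowerTri (Units.map K.subtype a) (s : R) (Units.map K.subtype d) := by
  ext i j; fin_cases i <;> fin_cases j <;> simp

theorem ofSubring_pivot (K : Subring R) (t : K) :
    GL2.ofSubring K (pivot t) = pivot (t : R) := by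
  ext i j; fin_cases i <;> fin_cases j <;> simp

/-- Different points of a `K`-chain are the first and second row of one matrix over `K`, relative
to the frame of the chain. -/
theorem exists_ofSubring_rows [Nontrivial R] [NoZeroDivisors R] {K : Subring R}
    (hK : IsSkewSubfield K) {h₁ h₂ : GL2 K} {g : GL2 R}
    (hne : Point.mk (GL2.ofSubring K h₁ * g) ≠ Point.mk (GL2.ofSubring K h₂ * g)) :
    ∃ h : GL2 K, Point.mk (GL2.ofSubring K h * g) = Point.mk (GL2.ofSubring K h₁ * g) ∧
      Point.mk (pivot 0 * (GL2.ofSubring K h * g)) = Point.mk (GL2.ofSubring K h₂ * g) := by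
  obtain ⟨k, rfl⟩ : ∃ k, h₂ = k * h₁ := ⟨h₂ * h₁⁻¹, by simp⟩
  by_cases hβ : k.val 0 1 = 0
  · obtain ⟨a, s, d, rfl⟩ := exists_eq_lowerTri_of_apply_eq_zero hβ
    rw [map_mul, ofSubring_lowerTri, mul_assoc, mk_lowerTri_mul] at hne
    exact absurd rfl hne
  · obtain ⟨c, hc, h1, h2⟩ := hK.exists_inv _ (k.val 0 1).2
      (fun h => hβ (Subtype.ext h))
    let β : Kˣ := ⟨k.val 0 1, ⟨c, hc⟩, Subtype.ext h1, Subtype.ext h2⟩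
    refine ⟨lowerTri 1 (k.val 0 0) β * h₁, ?_, ?_⟩
    · rw [map_mul, ofSubring_lowerTri, mul_assoc, mk_lowerTri_mul]
    · have e0 : (pivot 0 : GL2 R) = GL2.ofSubring K (pivot 0) := by simp [ofSubring_pivot]
      rw [e0, ← mul_assoc, ← map_mul, ← mul_assoc, map_mul, map_mul _ k, mul_assoc, mul_assoc]
      apply mk_eq_mk_of_row
      ext j
      rw [mul_row_zero, mul_row_zero (GL2.ofSubring K k) _ j]
      simp [mul_row_one, mul_row_zero, β]

theorem chain_ofSubring_mul (K : Subring R) (k : GL2 K) (g : GL2 R) :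
    {p | ∃ h : GL2 K, p = Point.mk (GL2.ofSubring K h * (GL2.ofSubring K k * g))} =
      {p | ∃ h : GL2 K, p = Point.mk (GL2.ofSubring K h * g)} := by
  ext p
  constructor
  · rintro ⟨h, rfl⟩
    exact ⟨h * k, by rw [map_mul, mul_assoc]⟩
  · rintro ⟨h, rfl⟩
    exact ⟨h * k⁻¹, by rw [← mul_assoc, ← map_mul, inv_mul_cancel_right]⟩

theorem existsUnique_chain [Nontrivial R] [NoZeroDivisors R] {K : Subring R}
    (hK : IsSkewSubfield K) (hunits : ∀ a : R, IsUnit a → a ∈ K) {p q : Point R}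
    (hpq : Distant p q) : ∃! C : Set (Point R), C ∈ chains K ∧ p ∈ C ∧ q ∈ C := by
  obtain ⟨g, hp, hq⟩ := distant_iff_exists_mk.mp hpq
  refine ⟨{p | ∃ h : GL2 K, p = Point.mk (GL2.ofSubring K h * g)}, ⟨⟨g, rfl⟩, ⟨1, ?_⟩,
    ⟨pivot 0, ?_⟩⟩, ?_⟩
  · rw [hp, map_one, one_mul]
  · rw [hq, ofSubring_pivot]; simp
  · rintro C ⟨⟨g', rfl⟩, ⟨h₁, hp'⟩, ⟨h₂, hq'⟩⟩
    obtain ⟨h, e1, e2⟩ := exists_ofSubring_rows hK (hp' ▸ hq' ▸ hpq.ne)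
    rw [← hp', hp] at e1
    rw [← hq', hq] at e2
    obtain ⟨a, s, d, e⟩ := exists_eq_lowerTri_mul_of_mk_eq e1
    rw [e, ← mul_assoc, pivot_zero_mul_lowerTri, mul_assoc, mk_lowerTri_mul] at e2
    have hs : s = 0 := by simpa using eq_of_mk_pivot_mul_eq e2
    subst hs
    -- the units `a` and `d` of `R` belong to `K`
    let lift (x : Rˣ) : Kˣ := ⟨⟨x, hunits _ x.isUnit⟩, ⟨↑x⁻¹, hunits _ x⁻¹.isUnit⟩,
      Subtype.ext (by simp), Subtype.ext (by simp)⟩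
    have hlift (x : Rˣ) : Units.map (K.subtype : K →* R) (lift x) = x := by ext; rfl
    have e' : g' = GL2.ofSubring K (h⁻¹ * lowerTri (lift a) 0 (lift d)) * g := by
      rw [map_mul, ofSubring_lowerTri, map_inv, mul_assoc, hlift, hlift,
        ZeroMemClass.coe_zero, ← e, inv_mul_cancel_left]
    rw [e']
    exact chain_ofSubring_mul K _ g

end Chains

theorem IsKRingWithDegree.noZeroDivisors {R : Type u} [Ring R] {K : Subring R}
    {deg : R → WithBot ℕ} (h : IsKRingWithDegree K deg) : NoZeroDivisors R where
  eq_zero_or_eq_zero_of_mul_eq_zero {a b} hab := by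
    have h1 := h.deg_mul a b
    rw [hab, h.deg_zero, eq_comm, WithBot.add_eq_bot, h.deg_eq_bot, h.deg_eq_bot] at h1
    exact h1

/-! ### Polynomials in one indeterminate -/

section OneVariable

open Polynomial

theorem isUnit_polynomial_iff {K : Type v} [DivisionRing K] {a : K[X]} :
    IsUnit a ↔ a.degree = 0 := by
  constructor
  · rintro ⟨a, rfl⟩
    have h := degree_mul (p := (a : K[X])) (q := ↑a⁻¹)
    rw [Units.mul_inv, degree_one, degree_eq_natDegree a.ne_zero,
      degree_eq_natDegree a⁻¹.ne_zero] at h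
    have h' : 0 = (a : K[X]).natDegree + (↑a⁻¹ : K[X]).natDegree := by exact_mod_cast h
    rw [degree_eq_natDegree a.ne_zero, (by omega : (a : K[X]).natDegree = 0), Nat.cast_zero]
  · intro h
    rw [eq_C_of_degree_eq_zero h]
    refine IsUnit.map C (IsUnit.mk0 _ fun h0 => ?_)
    rw [eq_C_of_degree_eq_zero h, h0, C_0, degree_zero] at h
    exact absurd h (by decide)

theorem isKRingWithDegree_polynomial (K : Type v) [DivisionRing K] :
    IsKRingWithDegree (C : K →+* K[X]).range degree where
  isSkewSubfield := {
    zero_ne_one := zero_ne_one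
    exists_inv := by
      rintro _ ⟨a, rfl⟩ ha
      have ha' : a ≠ 0 := by rintro rfl; simp at ha
      exact ⟨C a⁻¹, ⟨_, rfl⟩, by simp [← C_mul, ha'], by simp [← C_mul, ha']⟩ }
  mem_iff a := by
    rw [isUnit_polynomial_iff]
    constructor
    · rintro ⟨x, rfl⟩
      by_cases hx : x = 0
      · right; simp [hx]
      · left; exact degree_C hx
    · rintro (h | rfl)
      · exact ⟨_, (eq_C_of_degree_le_zero h.le).symm⟩
      · exact zero_mem _
  deg_eq_bot _ := degree_eq_bot
  deg_eq_zero _ := isUnit_polynomial_iff.symm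
  deg_add := degree_add_le
  deg_mul _ _ := degree_mul

theorem range_C_ne_top (K : Type v) [DivisionRing K] : (C : K →+* K[X]).range ≠ ⊤ := by
  intro h
  obtain ⟨a, ha⟩ : (X : K[X]) ∈ (C : K →+* K[X]).range := h ▸ Subring.mem_top _
  have := congrArg (fun p : K[X] => p.coeff 1) ha
  simp at this

theorem exists_degree_sub_mul_lt {K : Type v} [DivisionRing K] (a : K[X]) {b : K[X]}
    (hb : b ≠ 0) : ∃ q, (a - b * q).degree < b.degree := by
  have hm : (b * C b.leadingCoeff⁻¹).Monic := monic_mul_leadingCoeff_inv hb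
  refine ⟨C b.leadingCoeff⁻¹ * (a /ₘ (b * C b.leadingCoeff⁻¹)), ?_⟩
  rw [← mul_assoc, ← modByMonic_eq_sub_mul_div]
  simpa [degree_mul_leadingCoeff_inv _ hb] using degree_modByMonic_lt a hm

/-- The Euclidean algorithm in `K[X]`. -/
theorem GE2_polynomial_eq_top (K : Type v) [DivisionRing K] : GE2 K[X] = ⊤ := by
  refine (Subgroup.eq_top_iff' _).mpr fun g => ?_
  induction hn : (g.val 0 1).degree using WellFoundedLT.induction generalizing g with
  | ind n ih =>
    by_cases hb : g.val 0 1 = 0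
    · obtain ⟨a, s, d, rfl⟩ := exists_eq_lowerTri_of_apply_eq_zero hb
      exact lowerTri_mem_GE2 a s d
    · obtain ⟨q, hq⟩ := exists_degree_sub_mul_lt (g.val 0 0) hb
      have h := ih _ (hn ▸ hq) (g * (B21 (-q) * pivot 0)) (by
        congr 1
        simp [mul_row_zero, mul_row_one, sub_eq_add_neg])
      exact (mul_mem_cancel_right (mul_mem (B21_mem_GE2 (-q)) (pivot_mem_GE2 0))).mp h

theorem ediam_polynomial_eq_top (K : Type v) [DivisionRing K] :
    (distantGraph K[X]).ediam = ⊤ := by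
  have hd := isKRingWithDegree_polynomial K
  have h := hd.componentDiam_eq_top (range_C_ne_top K)
    ((distantGraph K[X]).connectedComponentMk (Point.mk 1))
  rw [eq_top_iff, ← h]
  exact iSup₂_le fun p _ => iSup₂_le fun q _ => SimpleGraph.edist_le_ediam

/-- In a principal ideal domain, a coprime triple `a, b, c` with `a ≠ 0` can be shortened: take
for `t` the product of the primes which divide `a` but not `b`. -/
theorem exists_isCoprime_add_mul {A : Type v} [CommRing A] [IsDomain A] [IsPrincipalIdealRing A]
    {a b c : A} (ha : a ≠ 0) (h : ∀ p, Prime p → p ∣ a → p ∣ b → ¬ p ∣ c) :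
    ∃ t, IsCoprime a (b + c * t) := by
  classical
  let s := (UniqueFactorizationMonoid.factors a).filter (fun p => ¬ p ∣ b)
  refine ⟨s.prod, isCoprime_of_prime_dvd (fun h0 => ha h0.1) fun p hp hpa hpt => ?_⟩
  by_cases hpb : p ∣ b
  · have hps : ¬ p ∣ s.prod := by
      intro hps
      obtain ⟨r, hr, hpr⟩ := hp.exists_mem_multiset_dvd hps
      obtain ⟨hr1, hr2⟩ := Multiset.mem_filter.mp hr
      have hr' := UniqueFactorizationMonoid.prime_of_factor r hr1
      exact hr2 ((hp.associated_of_dvd hr' hpr).symm.dvd.trans hpb)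
    rcases hp.dvd_or_dvd ((dvd_add_right hpb).mp hpt) with h1 | h1
    · exact h p hp hpa hpb h1
    · exact hps h1
  · obtain ⟨r, hr, hpr⟩ :=
      UniqueFactorizationMonoid.exists_mem_factors_of_dvd ha hp.irreducible hpa
    have hrs : r ∈ s := Multiset.mem_filter.mpr ⟨hr, fun h' => hpb (hpr.dvd.trans h')⟩
    have h2 : p ∣ c * s.prod := (hpr.dvd.trans (Multiset.dvd_prod hrs)).mul_left c
    exact hpb ((dvd_add_left h2).mp hpt)

theorem rowsShorten_two {A : Type v} [CommRing A] [IsDomain A] [IsPrincipalIdealRing A] :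
    RowsShorten A 2 := by
  rintro a ⟨x, hx⟩
  rw [Fin.sum_univ_three] at hx
  have hp : ∀ p, Prime p → p ∣ a 0 → p ∣ a 1 → ¬ p ∣ a 2 := fun p hp h0 h1 h2 =>
    hp.not_isUnit (isUnit_of_dvd_one (hx ▸ dvd_add (dvd_add (h0.mul_right _) (h1.mul_right _))
      (h2.mul_right _)))
  have close : ∀ b : Fin 2 → A, IsCoprime (a 0 + a 2 * b 0) (a 1 + a 2 * b 1) →
      ∃ b : Fin 2 → A, Unimodular (fun i : Fin 2 => a i.castSucc + a (Fin.last 2) * b i) := by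
    rintro b ⟨y, z, hyz⟩
    refine ⟨b, ![y, z], ?_⟩
    rw [Fin.sum_univ_two, ← hyz]
    exact congrArg₂ (· + ·) (mul_comm _ _) (mul_comm _ _)
  by_cases h0 : a 0 = 0
  · by_cases h1 : a 1 = 0
    · refine close ![1, 0] ?_
      rw [h0, h1, zero_mul, zero_mul, zero_add, zero_add] at hx
      have hu : IsCoprime (a 2) 0 := isCoprime_zero_right.mpr (IsUnit.of_mul_eq_one _ hx)
      simpa [h0, h1] using hu
    · obtain ⟨t, ht⟩ := exists_isCoprime_add_mul (c := a 2) h1 fun p h h1 h0 => hp p h h0 h1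
      refine close ![t, 0] ?_
      simpa using ht.symm
  · obtain ⟨t, ht⟩ := exists_isCoprime_add_mul (c := a 2) h0 hp
    refine close ![0, t] ?_
    simpa using ht

/-- The unimodular row `(X, 1 - X²)` cannot be shortened. -/
theorem not_rowsShorten_one (K : Type v) [DivisionRing K] : ¬ RowsShorten K[X] 1 := by
  intro h
  obtain ⟨b, x, hx⟩ := h ![X, 1 - X ^ 2] ⟨![X, 1], by simp [Fin.sum_univ_two, sq]⟩
  simp only [Finset.univ_unique, Fin.default_eq_zero, Fin.isValue, Finset.sum_singleton] at hx
  have hu : IsUnit (X + (1 - X ^ 2) * b 0 : K[X]) := IsUnit.of_mul_eq_one _ hx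
  rw [isUnit_polynomial_iff] at hu
  have h2 : (1 - X ^ 2 : K[X]).degree = 2 := by
    rw [← degree_neg, neg_sub]
    exact degree_X_pow_sub_C (by norm_num) 1
  by_cases hb : b 0 = 0
  · simp [hb] at hu
  · have hlt : (X : K[X]).degree < ((1 - X ^ 2) * b 0).degree := by
      rw [degree_mul, h2, degree_X, degree_eq_natDegree hb]
      exact_mod_cast (by omega : 1 < 2 + (b 0).natDegree)
    rw [degree_add_eq_right_of_degree_lt hlt, degree_mul, h2, degree_eq_natDegree hb] at hu
    have : 2 + (b 0).natDegree = 0 := by exact_mod_cast hu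
    omega

theorem not_rowsShorten_zero (A : Type v) [Ring A] [Nontrivial A] : ¬ RowsShorten A 0 := by
  intro h
  obtain ⟨b, x, hx⟩ := h ![1] ⟨![1], by simp⟩
  simp at hx

theorem hasStableRank_polynomial (K : Type v) [Field K] : HasStableRank K[X] 3 := by
  refine ⟨⟨2, rfl, rowsShorten_two⟩, ?_⟩
  rintro l ⟨n, rfl, hn⟩
  match n, hn with
  | 0, hn => exact absurd hn (not_rowsShorten_zero _)
  | 1, hn => exact absurd hn (not_rowsShorten_one K)
  | n + 2, _ => omega

end OneVariable

/-! ### The total degree of polynomials in several indeterminates -/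

section TotalDegree

variable {K : Type w} [DivisionRing K] {m : ℕ}

/-- The total degree on `K[X₁,…,Xₘ]`, with value `⊥` at `0`. -/
noncomputable def totalDeg (f : CentralPoly K m) : WithBot ℕ :=
  f.supDegree (fun d => ((d.degree : ℕ) : WithBot ℕ))

theorem totalDeg_mul_le (f g : CentralPoly K m) :
    totalDeg (f * g) ≤ totalDeg f + totalDeg g :=
  AddMonoidAlgebra.supDegree_mul_le (by intro a b; rw [map_add]; rfl)

theorem le_totalDeg {f : CentralPoly K m} {d : Fin m →₀ ℕ} (h : f.coeff d ≠ 0) :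
    (d.degree : WithBot ℕ) ≤ totalDeg f := by
  by_contra hlt
  exact h (AddMonoidAlgebra.coeff_eq_zero_of_not_le_supDegree
    (D := fun d : Fin m →₀ ℕ => ((d.degree : ℕ) : WithBot ℕ)) hlt)

/-- The greatest monomial of a polynomial, in the degree-lexicographic order, has maximal
degree. -/
theorem exists_leading_monomial {f : CentralPoly K m} (hf : f ≠ 0) :
    ∃ d, f.coeff d ≠ 0 ∧ totalDeg f = (d.degree : WithBot ℕ) ∧
      f.supDegree toDegLex = toDegLex d := by
  obtain ⟨d, hd, e⟩ := AddMonoidAlgebra.exists_supDegree_mem_support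
    (toDegLex : (Fin m →₀ ℕ) → DegLex (Fin m →₀ ℕ)) hf
  refine ⟨d, Finsupp.mem_support_iff.mp hd, ?_, e⟩
  refine AddMonoidAlgebra.supDegree_eq_of_isMaxOn hd fun c hc => ?_
  have h1 : toDegLex c ≤ toDegLex d := e ▸ Finset.le_sup (f := toDegLex) hc
  exact WithBot.coe_le_coe.mpr (Finsupp.DegLex.monotone_degree h1)

theorem exists_coeff_mul_ne_zero {f g : CentralPoly K m} (hf : f ≠ 0) (hg : g ≠ 0) :
    ∃ d, (f * g).coeff d ≠ 0 ∧ totalDeg f + totalDeg g = (d.degree : WithBot ℕ) := by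
  obtain ⟨a, ha, ha', ea⟩ := exists_leading_monomial hf
  obtain ⟨b, hb, hb', eb⟩ := exists_leading_monomial hg
  refine ⟨a + b, ?_, by rw [ha', hb', map_add]; rfl⟩
  rw [AddMonoidAlgebra.coeff_add_of_supDegree_le (D := toDegLex) (fun _ _ => toDegLex_add _ _)
    toDegLex_injective ea.le eb.le]
  exact mul_ne_zero ha hb

theorem totalDeg_eq_bot {f : CentralPoly K m} : totalDeg f = ⊥ ↔ f = 0 := by
  constructor
  · intro h
    by_contra hf
    obtain ⟨d, -, h', -⟩ := exists_leading_monomial hf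
    rw [h] at h'
    exact WithBot.bot_ne_coe h'
  · rintro rfl
    exact AddMonoidAlgebra.supDegree_zero

theorem totalDeg_mul (f g : CentralPoly K m) : totalDeg (f * g) = totalDeg f + totalDeg g := by
  by_cases hf : f = 0
  · rw [hf, zero_mul, totalDeg_eq_bot.mpr rfl, WithBot.bot_add]
  by_cases hg : g = 0
  · rw [hg, mul_zero, totalDeg_eq_bot.mpr rfl, WithBot.add_bot]
  obtain ⟨d, hd, e⟩ := exists_coeff_mul_ne_zero hf hg
  exact le_antisymm (totalDeg_mul_le f g) (e ▸ le_totalDeg hd)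

theorem totalDeg_single (d : Fin m →₀ ℕ) {c : K} (hc : c ≠ 0) :
    totalDeg (AddMonoidAlgebra.single d c : CentralPoly K m) = (d.degree : WithBot ℕ) :=
  AddMonoidAlgebra.supDegree_single_ne_zero _ hc

theorem eq_single_of_totalDeg_le_zero {f : CentralPoly K m} (h : totalDeg f ≤ 0) :
    f = AddMonoidAlgebra.single 0 (f.coeff 0) := by
  ext d
  by_cases hd : d = 0
  · simp [hd]
  · rw [AddMonoidAlgebra.coeff_single, Finsupp.single_eq_of_ne hd]
    by_contra hne
    have h1 := (le_totalDeg hne).trans h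
    have h2 : d.degree ≤ 0 := by exact_mod_cast h1
    exact hd ((Finsupp.degree_eq_zero_iff d).mp (Nat.le_zero.mp h2))

theorem mem_constants_iff {f : CentralPoly K m} :
    f ∈ constants K m ↔ ∃ c, AddMonoidAlgebra.single 0 c = f := Iff.rfl

theorem single_zero_mul_single_zero_inv {c : K} (hc : c ≠ 0) :
    (AddMonoidAlgebra.single 0 c * AddMonoidAlgebra.single 0 c⁻¹ : CentralPoly K m) = 1 ∧
    (AddMonoidAlgebra.single 0 c⁻¹ * AddMonoidAlgebra.single 0 c : CentralPoly K m) = 1 := by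
  simp [AddMonoidAlgebra.single_mul_single, hc, AddMonoidAlgebra.one_def]

theorem totalDeg_eq_zero_iff {f : CentralPoly K m} : totalDeg f = 0 ↔ IsUnit f := by
  constructor
  · intro h
    have e := eq_single_of_totalDeg_le_zero h.le
    have hc : f.coeff 0 ≠ 0 := by
      intro hc
      rw [hc, AddMonoidAlgebra.single_zero] at e
      rw [e, totalDeg_eq_bot.mpr rfl] at h
      exact absurd h (by decide)
    rw [e]
    obtain ⟨h1, h2⟩ := single_zero_mul_single_zero_inv (m := m) hc
    exact ⟨⟨_, _, h1, h2⟩, rfl⟩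
  · rintro ⟨f, rfl⟩
    have h := totalDeg_mul (f : CentralPoly K m) ↑f⁻¹
    obtain ⟨a, -, ha, -⟩ := exists_leading_monomial f.ne_zero
    obtain ⟨b, -, hb, -⟩ := exists_leading_monomial f⁻¹.ne_zero
    rw [Units.mul_inv, ha, hb, AddMonoidAlgebra.one_def, totalDeg_single _ one_ne_zero] at h
    have h' : (0 : Fin m →₀ ℕ).degree = a.degree + b.degree := by exact_mod_cast h
    rw [map_zero] at h'
    rw [ha, (by omega : a.degree = 0)]
    rfl

theorem isSkewSubfield_constants : IsSkewSubfield (constants K m) where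
  zero_ne_one := zero_ne_one
  exists_inv := by
    rintro _ ⟨c, rfl⟩ hc
    have hc' : c ≠ 0 := by rintro rfl; simp at hc
    exact ⟨AddMonoidAlgebra.single 0 c⁻¹, ⟨_, rfl⟩, single_zero_mul_single_zero_inv hc'⟩

variable (K m) in
theorem isKRingWithDegree_centralPoly : IsKRingWithDegree (constants K m) totalDeg where
  isSkewSubfield := isSkewSubfield_constants
  mem_iff f := by
    rw [mem_constants_iff, ← totalDeg_eq_zero_iff]
    constructor
    · rintro ⟨c, rfl⟩
      by_cases hc : c = 0
      · right; rw [hc, AddMonoidAlgebra.single_zero]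
      · left; rw [totalDeg_single _ hc, map_zero]; rfl
    · rintro (h | rfl)
      · exact ⟨_, (eq_single_of_totalDeg_le_zero h.le).symm⟩
      · exact ⟨0, AddMonoidAlgebra.single_zero _⟩
  deg_eq_bot _ := totalDeg_eq_bot
  deg_eq_zero _ := totalDeg_eq_zero_iff
  deg_add _ _ := AddMonoidAlgebra.supDegree_add_le
  deg_mul := totalDeg_mul

theorem constants_ne_top (hm : 0 < m) : constants K m ≠ ⊤ := by
  intro h
  obtain ⟨c, hc⟩ := mem_constants_iff.mp (h ▸ Subring.mem_top (var K (⟨0, hm⟩ : Fin m)))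
  have h1 := totalDeg_single (K := K) (Finsupp.single (⟨0, hm⟩ : Fin m) 1) one_ne_zero
  have h2 : totalDeg (var K (⟨0, hm⟩ : Fin m)) ≤ 0 := by
    rw [← hc]
    by_cases hc0 : c = 0
    · rw [hc0, AddMonoidAlgebra.single_zero, totalDeg_eq_bot.mpr rfl]; exact bot_le
    · rw [totalDeg_single _ hc0, map_zero]; rfl
  rw [var, h1, Finsupp.degree_single] at h2
  exact absurd h2 (by decide)

theorem constants_le_center (h : ∀ a b : K, a * b = b * a) :
    constants K m ≤ Subring.center (CentralPoly K m) := by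
  rintro _ ⟨c, rfl⟩
  rw [Subring.mem_center_iff]
  intro f
  ext d
  change (f * AddMonoidAlgebra.single 0 c).coeff d = (AddMonoidAlgebra.single 0 c * f).coeff d
  rw [AddMonoidAlgebra.coeff_mul_single_zero, AddMonoidAlgebra.coeff_single_zero_mul, h]

end TotalDegree

/-! ### Polynomials in two of the indeterminates -/

section TwoVariables

variable {K : Type w} [DivisionRing K] {m : ℕ}

/-- The monomial `c Xᵢᵖ Xⱼ^q`. -/
noncomputable def biMonomial (i j : Fin m) (c : K) (p q : ℕ) : CentralPoly K m :=
  AddMonoidAlgebra.single (Finsupp.single i p + Finsupp.single j q) c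

theorem biMonomial_mul (i j : Fin m) (c c' : K) (p q p' q' : ℕ) :
    biMonomial i j c p q * biMonomial i j c' p' q' =
      biMonomial i j (c * c') (p + p') (q + q') := by
  rw [biMonomial, biMonomial, AddMonoidAlgebra.single_mul_single, biMonomial, Finsupp.single_add,
    Finsupp.single_add, add_add_add_comm]

theorem var_left_eq (i j : Fin m) : var K i = biMonomial i j 1 1 0 := by
  simp [biMonomial, var]

theorem var_right_eq (i j : Fin m) : var K j = biMonomial i j 1 0 1 := by
  simp [biMonomial, var]

theorem one_eq_biMonomial (i j : Fin m) : (1 : CentralPoly K m) = biMonomial i j 1 0 0 := by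
  simp [biMonomial, AddMonoidAlgebra.one_def]

theorem zsmul_biMonomial (i j : Fin m) (n : ℤ) (c : K) (p q : ℕ) :
    n • biMonomial i j c p q = biMonomial i j (n * c) p q := by
  rw [biMonomial, AddMonoidAlgebra.smul_single, zsmul_eq_mul, biMonomial]

theorem biMonomial_neg (i j : Fin m) (c : K) (p q : ℕ) :
    biMonomial i j (-c) p q = -biMonomial i j c p q :=
  AddMonoidAlgebra.single_neg _ _

theorem totalDeg_biMonomial (i j : Fin m) {c : K} (hc : c ≠ 0) (p q : ℕ) :
    totalDeg (biMonomial i j c p q) = ((p + q : ℕ) : WithBot ℕ) := by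
  rw [biMonomial, totalDeg_single _ hc, map_add, Finsupp.degree_single, Finsupp.degree_single]

theorem single_add_single_inj {i j : Fin m} (hij : i ≠ j) {p q p' q' : ℕ} :
    Finsupp.single i p + Finsupp.single j q = Finsupp.single i p' + Finsupp.single j q' ↔
      p = p' ∧ q = q' := by
  constructor
  · intro h
    have h1 := DFunLike.congr_fun h i
    have h2 := DFunLike.congr_fun h j
    simp [hij, hij.symm] at h1 h2
    exact ⟨h1, h2⟩
  · rintro ⟨rfl, rfl⟩; rfl

theorem coeff_biMonomial {i j : Fin m} (hij : i ≠ j) (c : K) (p q p' q' : ℕ) :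
    (biMonomial i j c p q).coeff (Finsupp.single i p' + Finsupp.single j q') =
      if p = p' ∧ q = q' then c else 0 := by
  classical
  rw [biMonomial, AddMonoidAlgebra.coeff_single, Finsupp.single_apply]
  simp only [single_add_single_inj hij]

theorem coeff_biMonomial_mul_of_lt {i j : Fin m} (hij : i ≠ j) (c : K) {p q p' q' : ℕ}
    (h : p' < p) (f : CentralPoly K m) :
    (biMonomial i j c p q * f).coeff (Finsupp.single i p' + Finsupp.single j q') = 0 := by
  refine AddMonoidAlgebra.coeff_single_mul_of_forall_add_ne _ _ fun d hd => ?_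
  have h1 := DFunLike.congr_fun hd i
  simp [hij] at h1
  omega

end TwoVariables

/-! ### Unipotent matrices outside `GE₂` -/

section Cohn

/-- The power `(1 + N)ⁿ = 1 + n N` for an element `N` of square `0`. -/
def oneAddZSMul {S : Type u} [Ring S] (N : S) (h : N * N = 0) (n : ℤ) : Sˣ :=
  ⟨1 + n • N, 1 - n • N, by simp [mul_sub, add_mul, h, -zsmul_eq_mul],
    by simp [mul_add, sub_mul, h, -zsmul_eq_mul]⟩

theorem oneAddZSMul_mul {S : Type u} [Ring S] (N : S) (h : N * N = 0) (n k : ℤ) :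
    oneAddZSMul N h n * oneAddZSMul N h k = oneAddZSMul N h (n + k) := by
  ext
  simp only [oneAddZSMul, Units.val_mul]
  simp [mul_add, add_mul, h, add_smul, add_assoc, -zsmul_eq_mul]

theorem oneAddZSMul_neg {S : Type u} [Ring S] (N : S) (h : N * N = 0) (n : ℤ) :
    oneAddZSMul N h (-n) = (oneAddZSMul N h n)⁻¹ := by
  rw [eq_inv_iff_mul_eq_one, oneAddZSMul_mul]
  ext
  simp [oneAddZSMul]

theorem oneAddZSMul_one_zpow {S : Type u} [Ring S] (N : S) (h : N * N = 0) (n : ℤ) :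
    oneAddZSMul N h 1 ^ n = oneAddZSMul N h n := by
  induction n using Int.induction_on with
  | zero => ext; simp [oneAddZSMul]
  | succ n ih => rw [zpow_add_one, ih, oneAddZSMul_mul]
  | pred n ih => rw [zpow_sub_one, ih, ← oneAddZSMul_neg, oneAddZSMul_mul]; rfl

variable {K : Type w} [DivisionRing K] {m : ℕ}

variable (K) in
/-- The nilpotent matrix `N`, the product of the column `(Xᵢ, -Xⱼ)` and the row `(Xⱼ, Xᵢ)`. -/
noncomputable def cohnNilpotent (i j : Fin m) : Matrix (Fin 2) (Fin 2) (CentralPoly K m) :=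
  !![biMonomial i j 1 1 1, biMonomial i j 1 2 0; -biMonomial i j 1 0 2, -biMonomial i j 1 1 1]

theorem cohnNilpotent_mul_self (i j : Fin m) : cohnNilpotent K i j * cohnNilpotent K i j = 0 := by
  ext a b; fin_cases a <;> fin_cases b <;> simp [cohnNilpotent, biMonomial_mul]

variable (K) in
/-- The matrix `Aⁿ = 1 + n N`, where `A` is Cohn's example of a matrix which is not a product of
elementary and diagonal matrices. -/
noncomputable def cohnMatrix (i j : Fin m) (n : ℤ) : GL2 (CentralPoly K m) :=
  oneAddZSMul (cohnNilpotent K i j) (cohnNilpotent_mul_self i j) n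

theorem cohnMatrix_one_zpow (i j : Fin m) (n : ℤ) :
    cohnMatrix K i j 1 ^ n = cohnMatrix K i j n :=
  oneAddZSMul_one_zpow _ _ n

theorem cohnMatrix_neg (i j : Fin m) (n : ℤ) :
    cohnMatrix K i j (-n) = (cohnMatrix K i j n)⁻¹ :=
  oneAddZSMul_neg _ _ n

theorem val_cohnMatrix (i j : Fin m) (n : ℤ) :
    (cohnMatrix K i j n).val =
      !![biMonomial i j 1 0 0 + biMonomial i j (n : K) 1 1, biMonomial i j (n : K) 2 0;
        -biMonomial i j (n : K) 0 2, biMonomial i j 1 0 0 - biMonomial i j (n : K) 1 1] := by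
  ext a b : 1
  fin_cases a <;> fin_cases b <;>
    simp [cohnMatrix, oneAddZSMul, cohnNilpotent, zsmul_biMonomial, one_eq_biMonomial i j,
      sub_eq_add_neg, -zsmul_eq_mul]

theorem val_cohnMatrix' (i j : Fin m) (n : ℤ) :
    (cohnMatrix K i j n).val =
      !![1 + (n : CentralPoly K m) * (var K i * var K j), (n : CentralPoly K m) * var K i ^ 2;
        -((n : CentralPoly K m) * var K j ^ 2), 1 - (n : CentralPoly K m) * (var K i * var K j)] := by
  rw [val_cohnMatrix, var_left_eq i j, var_right_eq i j, one_eq_biMonomial i j]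
  simp only [sq, biMonomial_mul, ← zsmul_eq_mul, zsmul_biMonomial, mul_one, add_zero, zero_add,
    one_add_one_eq_two]

/-- In the first row `(1 + n Xᵢ Xⱼ, n Xᵢ²)` no right multiple of the second entry cancels the
monomial `Xᵢ Xⱼ` of the first. -/
theorem cohnMatrix_notMem_GE2 {i j : Fin m} (hij : i ≠ j) {n : ℤ} (hn : (n : K) ≠ 0) :
    cohnMatrix K i j n ∉ GE2 (CentralPoly K m) := by
  intro hg
  have hd := isKRingWithDegree_centralPoly K m
  have h01 : totalDeg ((cohnMatrix K i j n).val 0 1) = 2 := by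
    rw [val_cohnMatrix]
    exact totalDeg_biMonomial i j hn 2 0
  obtain ⟨t, ht⟩ := hd.exists_deg_sub_lt_of_mem_GE2 hg (by
    intro h0
    rw [h0, totalDeg_eq_bot.mpr rfl] at h01
    exact absurd h01 (by decide))
  rw [h01] at ht
  refine ht.not_ge ?_
  have hdeg : (Finsupp.single i 1 + Finsupp.single j 1 : Fin m →₀ ℕ).degree = 2 := by
    rw [map_add, Finsupp.degree_single, Finsupp.degree_single]
  have key := le_totalDeg (f := (cohnMatrix K i j n).val 0 0 - (cohnMatrix K i j n).val 0 1 * t)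
    (d := Finsupp.single i 1 + Finsupp.single j 1) (by
      rw [val_cohnMatrix]
      simp [coeff_biMonomial hij, coeff_biMonomial_mul_of_lt hij, hn])
  rw [hdeg] at key
  exact key

theorem mul_B12_mul_inv_row_zero {R : Type u} [Ring R] (g : GL2 R) (j : Fin 2) :
    (g * B12 1 * g⁻¹).val 0 j =
      (1 : Matrix (Fin 2) (Fin 2) R) 0 j + g.val 0 0 * (g⁻¹).val 1 j := by
  have h : (g * g⁻¹).val 0 j = (1 : Matrix (Fin 2) (Fin 2) R) 0 j := by simp
  rw [← h, mul_row_zero, mul_row_zero, mul_row_zero, mul_row_zero]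
  simp
  noncomm_ring

/-- For `n = ε = ±1`, the first row is `(1 + ε Xⱼ² + Xᵢ Xⱼ³, (1 + ε Xᵢ Xⱼ)²)`, with entries of
degree `4`; only a constant multiple of the second entry could lower the degree of the first, but
it does not contain the monomial `Xᵢ Xⱼ³`. -/
theorem cohnMatrix_conj_notMem_GE2 {i j : Fin m} (hij : i ≠ j) {n : ℤ} (hn : n * n = 1) :
    cohnMatrix K i j n * B12 1 * (cohnMatrix K i j n)⁻¹ ∉ GE2 (CentralPoly K m) := by
  intro hg
  have hd := isKRingWithDegree_centralPoly K m
  have hn1 : (n : K) * n = 1 := by exact_mod_cast congrArg (Int.cast : ℤ → K) hn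
  have hn0 : (n : K) ≠ 0 := left_ne_zero_of_mul_eq_one hn1
  set g := cohnMatrix K i j n * B12 1 * (cohnMatrix K i j n)⁻¹ with hgdef
  have ha : g.val 0 0 =
      biMonomial i j 1 0 0 + (biMonomial i j (n : K) 0 2 + biMonomial i j 1 1 3) := by
    rw [hgdef, mul_B12_mul_inv_row_zero, ← cohnMatrix_neg, val_cohnMatrix, val_cohnMatrix]
    simp only [Matrix.one_apply_eq, one_eq_biMonomial i j, Matrix.cons_val', Matrix.cons_val_zero,
      Matrix.cons_val_fin_one, Matrix.cons_val_one, Matrix.of_apply]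
    rw [Int.cast_neg, biMonomial_neg, neg_neg]
    rw [add_mul, biMonomial_mul, biMonomial_mul, one_mul, hn1]
  have hb : g.val 0 1 = (biMonomial i j (n : K) 1 1 + biMonomial i j 1 0 0) *
      (biMonomial i j (n : K) 1 1 + biMonomial i j 1 0 0) := by
    rw [hgdef, mul_B12_mul_inv_row_zero, ← cohnMatrix_neg, val_cohnMatrix, val_cohnMatrix]
    simp only [Matrix.cons_val', Matrix.cons_val_zero,
      Matrix.cons_val_fin_one, Matrix.cons_val_one, Matrix.of_apply]
    rw [Int.cast_neg, biMonomial_neg, sub_neg_eq_add, add_comm (biMonomial i j 1 0 0)]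
    simp
  have d1 : totalDeg (biMonomial i j (n : K) 1 1 + biMonomial i j 1 0 0) = 2 := by
    rw [hd.deg_add_eq_left]
    · exact totalDeg_biMonomial i j hn0 1 1
    · rw [totalDeg_biMonomial i j hn0, totalDeg_biMonomial i j one_ne_zero]
      decide
  have db : totalDeg (g.val 0 1) = 4 := by
    rw [hb, totalDeg_mul, d1]; rfl
  have da : totalDeg (g.val 0 0) ≤ 4 := by
    rw [ha]
    refine (hd.deg_add _ _).trans (max_le ?_ ((hd.deg_add _ _).trans (max_le ?_ ?_)))
    · rw [totalDeg_biMonomial i j one_ne_zero]; decide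
    · rw [totalDeg_biMonomial i j hn0]; decide
    · rw [totalDeg_biMonomial i j one_ne_zero]; decide
  obtain ⟨t, ht⟩ := hd.exists_deg_sub_lt_of_mem_GE2 hg (by
    intro h0
    rw [h0, totalDeg_eq_bot.mpr rfl] at db
    exact absurd db (by decide))
  rw [db] at ht
  have hbt : totalDeg (g.val 0 1 * t) ≤ 4 := by
    have h1 := hd.deg_sub (g.val 0 0) (g.val 0 0 - g.val 0 1 * t)
    rw [sub_sub_cancel] at h1
    exact h1.trans (max_le da ht.le)
  rw [totalDeg_mul, db] at hbt
  have ht0 : totalDeg t ≤ 0 := by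
    generalize totalDeg t = x at hbt
    cases x with
    | bot => exact bot_le
    | coe x =>
      have h1 : 4 + x ≤ 4 := WithBot.coe_le_coe.mp hbt
      exact WithBot.coe_le_coe.mpr (by omega : x ≤ 0)
  refine ht.not_ge ?_
  have hdeg : (Finsupp.single i 1 + Finsupp.single j 3 : Fin m →₀ ℕ).degree = 4 := by
    rw [map_add, Finsupp.degree_single, Finsupp.degree_single]
  have key := le_totalDeg (f := g.val 0 0 - g.val 0 1 * t)
    (d := Finsupp.single i 1 + Finsupp.single j 3) (by
      rw [eq_single_of_totalDeg_le_zero ht0, ha, hb, AddMonoidAlgebra.coeff_sub,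
        Finsupp.sub_apply, AddMonoidAlgebra.coeff_mul_single_zero]
      simp [add_mul, mul_add, biMonomial_mul, coeff_biMonomial hij])
  rw [hdeg] at key
  exact key

end Cohn

/-! ### The projective line over `K[X₁,…,Xₘ]` -/

section Components

variable {K : Type w} [DivisionRing K] {m : ℕ}

theorem not_normal_of_conj_notMem {R : Type u} [Ring R] {H : Subgroup (GL2 R)} (hE : E2 R ≤ H)
    (hH : H ≤ GE2 R) {g : GL2 R} (hg : g * B12 1 * g⁻¹ ∉ GE2 R) : ¬ H.Normal := fun hn =>
  hg (hH (hn.conj_mem _ (hE (Subgroup.subset_closure (Or.inl ⟨1, rfl⟩))) g))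

theorem E2_le_GE2 (R : Type u) [Ring R] : E2 R ≤ GE2 R := fun _ h =>
  Subgroup.subset_closure (Or.inl h)

theorem ringChar_dvd_of_connectedComponentMk_eq {i j : Fin m} (hij : i ≠ j) {n k : ℤ}
    (h : (distantGraph (CentralPoly K m)).connectedComponentMk (Point.mk (cohnMatrix K i j n)) =
      (distantGraph (CentralPoly K m)).connectedComponentMk (Point.mk (cohnMatrix K i j k))) :
    (ringChar K : ℤ) ∣ k - n := by
  rw [connectedComponentMk_eq_iff, ← cohnMatrix_neg, cohnMatrix, cohnMatrix, oneAddZSMul_mul,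
    ← cohnMatrix, ← sub_eq_add_neg] at h
  rw [← CharP.intCast_eq_zero_iff K (ringChar K)]
  by_contra hne
  exact cohnMatrix_notMem_GE2 hij hne h

/-- The components of the points given by `Aⁿ` are infinitely many in characteristic `0`. -/
theorem infinite_components {i j : Fin m} (hij : i ≠ j) (h0 : ringChar K = 0) :
    Infinite (distantGraph (CentralPoly K m)).ConnectedComponent := by
  refine Infinite.of_injective (fun n : ℤ =>
    (distantGraph (CentralPoly K m)).connectedComponentMk (Point.mk (cohnMatrix K i j n))) ?_
  intro n k h
  have h1 := ringChar_dvd_of_connectedComponentMk_eq hij h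
  rw [h0, Nat.cast_zero, zero_dvd_iff] at h1
  omega

theorem ringChar_le_card_components {i j : Fin m} (hij : i ≠ j) :
    (ringChar K : ℕ∞) ≤ ENat.card (distantGraph (CentralPoly K m)).ConnectedComponent := by
  have hinj : Function.Injective (fun n : Fin (ringChar K) =>
      (distantGraph (CentralPoly K m)).connectedComponentMk
        (Point.mk (cohnMatrix K i j (n : ℕ)))) := by
    intro n k h
    have h1 := ringChar_dvd_of_connectedComponentMk_eq hij h
    have h2 := Int.eq_zero_of_abs_lt_dvd h1 (by rw [abs_lt]; omega)
    omega
  simpa using ENat.card_le_card_of_injective hinj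

/-- The cosets of `1`, `A` and `A B₁₂(1)` are different. -/
theorem three_le_card_components {i j : Fin m} (hij : i ≠ j) :
    3 ≤ ENat.card (distantGraph (CentralPoly K m)).ConnectedComponent := by
  have hA : cohnMatrix K i j 1 ∉ GE2 (CentralPoly K m) :=
    cohnMatrix_notMem_GE2 hij (by simp)
  have hB := cohnMatrix_conj_notMem_GE2 (K := K) hij (n := 1) (by norm_num)
  set A := cohnMatrix K i j 1
  let f : Fin 3 → (distantGraph (CentralPoly K m)).ConnectedComponent := fun a =>
    (distantGraph (CentralPoly K m)).connectedComponentMk (Point.mk (![1, A, A * B12 1] a))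
  have h01 : f 0 ≠ f 1 := fun h => hA (by simpa using connectedComponentMk_eq_iff.mp h)
  have h02 : f 0 ≠ f 2 := fun h => hA ((mul_mem_cancel_right (B12_mem_GE2 1)).mp
    (by simpa using connectedComponentMk_eq_iff.mp h))
  have h12 : f 1 ≠ f 2 := fun h => hB (by simpa using connectedComponentMk_eq_iff.mp h)
  have hinj : Function.Injective f := by
    intro a b h
    fin_cases a <;> fin_cases b <;> first | rfl | exact absurd h ‹_› | exact absurd h.symm ‹_›
  simpa using ENat.card_le_card_of_injective hinj

theorem not_connected_centralPoly {i j : Fin m} (hij : i ≠ j) :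
    ¬ (distantGraph (CentralPoly K m)).Connected := by
  rw [connected_iff]
  intro h
  exact cohnMatrix_notMem_GE2 (K := K) hij (n := 1) (by simp) (h ▸ Subgroup.mem_top _)

end Components

end ProjLine

open ProjLine
theorem mainTheorem5 :
    -- (a) rings with a degree function
    (∀ (R : Type u) [Ring R] (K : Subring R) (deg : R → WithBot ℕ),
      IsKRingWithDegree K deg → K ≠ ⊤ →
        (∀ c : (distantGraph R).ConnectedComponent, componentDiam (distantGraph R) c = ⊤) ∧
        (∀ p q : Point R, Distant p q → ∃! C : Set (Point R), C ∈ chains K ∧ p ∈ C ∧ q ∈ C)) ∧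
    -- (b) polynomials in one central indeterminate
    (∀ (K : Type v) [DivisionRing K],
      (distantGraph (Polynomial K)).Connected ∧
      (distantGraph (Polynomial K)).ediam = ⊤ ∧
      ((∀ a b : K, a * b = b * a) → HasStableRank (Polynomial K) 3)) ∧
    -- (c) polynomials in more than one central indeterminate
    (∀ (K : Type w) [DivisionRing K] (m : ℕ) (hm : 1 < m),
      (∃ A : GL2 (CentralPoly K m),
        (∀ n : ℤ, ((A ^ n : GL2 (CentralPoly K m)) : Matrix (Fin 2) (Fin 2) (CentralPoly K m)) =
          !![1 + (n : CentralPoly K m) * (var K ⟨0, by omega⟩ * var K ⟨1, hm⟩),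
              (n : CentralPoly K m) * var K ⟨0, by omega⟩ ^ 2;
            -((n : CentralPoly K m) * var K ⟨1, hm⟩ ^ 2),
              1 - (n : CentralPoly K m) * (var K ⟨0, by omega⟩ * var K ⟨1, hm⟩)]) ∧
        (∀ n : ℤ, ¬ (ringChar K : ℤ) ∣ n → A ^ n ∉ GE2 (CentralPoly K m)) ∧
        A⁻¹ * B12 1 * A ∉ GE2 (CentralPoly K m) ∧ A * B12 1 * A⁻¹ ∉ GE2 (CentralPoly K m)) ∧
      ¬ (E2 (CentralPoly K m)).Normal ∧ ¬ (GE2 (CentralPoly K m)).Normal ∧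
      ¬ (distantGraph (CentralPoly K m)).Connected ∧
      Nonempty (Quotient (QuotientGroup.rightRel (GE2 (CentralPoly K m))) ≃
        (distantGraph (CentralPoly K m)).ConnectedComponent) ∧
      (ringChar K = 0 → Infinite (distantGraph (CentralPoly K m)).ConnectedComponent) ∧
      (ringChar K ≠ 0 →
        (ringChar K : ℕ∞) ≤ ENat.card (distantGraph (CentralPoly K m)).ConnectedComponent) ∧
      (ringChar K = 2 → 3 ≤ ENat.card (distantGraph (CentralPoly K m)).ConnectedComponent) ∧
      (∀ c : (distantGraph (CentralPoly K m)).ConnectedComponent,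
        componentDiam (distantGraph (CentralPoly K m)) c = ⊤) ∧
      IsDisconnectedGeneralizedChainGeometry (constants K m) ∧
      ((∀ a b : K, a * b = b * a) → IsDisconnectedChainGeometry (constants K m))) := by
  refine ⟨fun R _ K deg hd hK => ⟨hd.componentDiam_eq_top hK, fun p q hpq => ?_⟩,
    fun K _ => ⟨connected_iff.mpr (GE2_polynomial_eq_top K), ediam_polynomial_eq_top K,
      fun hc => ?_⟩, fun K _ m hm => ?_⟩
  · have := hd.nontrivial
    have := hd.noZeroDivisors
    exact existsUnique_chain hd.isSkewSubfield (fun a ha => (hd.mem_iff a).mpr (Or.inl ha)) hpq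
  · let : Field K := { ‹DivisionRing K› with mul_comm := hc }
    exact hasStableRank_polynomial K
  · have hij : (⟨0, by omega⟩ : Fin m) ≠ ⟨1, hm⟩ := by simp
    have hconj := cohnMatrix_conj_notMem_GE2 (K := K) hij (n := 1) (by norm_num)
    have hconj' := cohnMatrix_conj_notMem_GE2 (K := K) hij (n := -1) (by norm_num)
    rw [cohnMatrix_neg, inv_inv] at hconj'
    have hdis := not_connected_centralPoly (K := K) hij
    refine ⟨⟨cohnMatrix K ⟨0, by omega⟩ ⟨1, hm⟩ 1, fun n => ?_, fun n hn => ?_, hconj', hconj⟩,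
      not_normal_of_conj_notMem le_rfl (E2_le_GE2 _) hconj,
      not_normal_of_conj_notMem (E2_le_GE2 _) le_rfl hconj, hdis, ⟨cosetEquivComponent _⟩,
      infinite_components hij, fun _ => ringChar_le_card_components hij,
      fun _ => three_le_card_components hij,
      (isKRingWithDegree_centralPoly K m).componentDiam_eq_top (constants_ne_top (by omega)),
      ⟨isSkewSubfield_constants, hdis⟩,
      fun hc => ⟨⟨isSkewSubfield_constants, hdis⟩, constants_le_center hc⟩⟩
    · rw [cohnMatrix_one_zpow, val_cohnMatrix']
    · rw [cohnMatrix_one_zpow]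
      exact cohnMatrix_notMem_GE2 hij (mt (CharP.intCast_eq_zero_iff K (ringChar K) n).mp hn)
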